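/- **Lemma (Adjoint of $L$).** Let $M$ be a smooth $n$-dimensional manifold without boundary (Hausdorff and second countable) with the following data. * $K$ is a smooth, symmetric, non-negative definite contravariant 2-tensor field on $M$ (possibly degenerate). * $J$ is a smooth alternating contravariant 2-tensor field on $M$ (possibly degenerate) whose bracket $\{f,g\}=J(df,dg)$ satisfies the Jacobi identity on $C^\infty(M)$. * $\nu$ is a smooth nowhere vanishing volume form on $M$. We orient $M$ by $\nu$ and also write $\nu$ for the corresponding positive measure. The divergence of a smooth vector field $X$ is defined by $\mathcal L_X\nu=\operatorname{div}_\nu(X)\,\nu$. * $E,S\in C^\infty(M)$. Assume the non-interaction conditions $J(dS,\cdot)=0$ and $K(dE,\cdot)=0$, and the unimodularity condition $\operatorname{div}_\nu(J(dh,\cdot))=0$ for all $h\in C^\infty(M)$. For $f\in C_c^\infty(M)$ define $$\Delta_{\mathcal H} f=\operatorname{div}_\nu\big(K(df,\cdot)\big),\qquad \Delta_{\mathcal H,S}f=\Delta_{\mathcal H}f+K(dS,df),$$ $$L_af=J(dE,df),\qquad L_sf=\Delta_{\mathcal H,S}f,\qquad Lf=J(dE,df)+K(dS,df)+\Delta_{\mathcal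 H}f .$$ Then $L=L_a+L_s$, and $L$, $L_a$, $L_s$ are well-defined, densely defined linear operators in the real Hilbert space $L^2(M;e^{S}\nu)$ with domain $C_c^\infty(M)$. In this space $L_a$ is antisymmetric and $L_s$ is symmetric: for all $f,h\in C_c^\infty(M)$, $$\langle L_af,h\rangle=-\langle f,L_ah\rangle,\qquad \langle L_sf,h\rangle=\langle f,L_sh\rangle .$$ Consequently, the domain of the adjoint $L^*$ of $L$ in $L^2(M;e^{S}\nu)$ contains $C_c^\infty(M)$, and $$L^*f=-L_af+L_sf=-J(dE,df)+\Delta_{\mathcal H,S}f\qquad\text{for all } f\in C_c^\infty(M).$$ -/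

import Mathlib

open scoped Manifold ContDiff ENNReal
open MeasureTheory

noncomputable section

namespace GGeneric

/-- The model space `ℝⁿ` of an `n`-dimensional manifold, with its Euclidean structure. -/
abbrev Model (n : ℕ) : Type := EuclideanSpace ℝ (Fin n)

section Tensors

variable (n : ℕ) (M : Type*) [TopologicalSpace M] [ChartedSpace (Model n) M]

/-- The tangent space `T_x M`. -/
abbrev Tan {M : Type*} [TopologicalSpace M] [ChartedSpace (Model n) M] (x : M) : Type :=
  TangentSpace 𝓘(ℝ, Model n) x

/-- The cotangent space `T*_x M`. -/
abbrev Cotan {M : Type*} [TopologicalSpace M] [ChartedSpace (Model n) M] (x : M) : Type :=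
  Tan n x →L[ℝ] ℝ

variable {M}

/-- The differential `df_x ∈ T*_x M` of a real function. -/
def diff (f : M → ℝ) (x : M) : Cotan n x := mvfderiv 𝓘(ℝ, Model n) f x

variable {n}

/-- The coordinate differential `dxⁱ` at `x` of a chart `e = (x¹, …, xⁿ)`. -/
def coordDiff (e : OpenPartialHomeomorph M (Model n)) (i : Fin n) (x : M) : Cotan n x :=
  diff n (fun z => e z i) x

/-- The coordinate vector `∂/∂xⁱ` of a chart `e`, at the point with coordinates `y`. -/
def coordVec (e : OpenPartialHomeomorph M (Model n)) (i : Fin n) (y : Model n) :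
    Tan n (e.symm y) :=
  mfderiv 𝓘(ℝ, Model n) 𝓘(ℝ, Model n) e.symm y (EuclideanSpace.single i (1 : ℝ) : Model n)

variable (n M)

/-- A smooth contravariant 2-tensor field: a bilinear form on every cotangent space, whose
components `A(dxⁱ, dxʲ)` are smooth in every chart. -/
structure ContraTwoTensor where
  form : ∀ x : M, Cotan n x →ₗ[ℝ] Cotan n x →ₗ[ℝ] ℝ
  smooth : ∀ e ∈ atlas (Model n) M, ∀ i j : Fin n,
    ContDiffOn ℝ ∞
      (fun y => form (e.symm y) (coordDiff e i (e.symm y)) (coordDiff e j (e.symm y))) e.target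

/-- A non-degenerate volume form: a smooth nowhere vanishing differential form of top degree.
Smoothness is smoothness of `ν(∂/∂x¹, …, ∂/∂xⁿ)` in every chart. -/
structure VolumeForm where
  form : ∀ x : M, Tan n x [⋀^Fin n]→ₗ[ℝ] ℝ
  smooth : ∀ e ∈ atlas (Model n) M,
    ContDiffOn ℝ ∞ (fun y => form (e.symm y) (fun i => coordVec e i y)) e.target
  ne_zero : ∀ x, form x ≠ 0

variable {n M}

/-- The vector `♯α = A(α, ·) ∈ T_x M` associated with a covector `α`; see `apply_sharp`. -/
def ContraTwoTensor.sharp (A : ContraTwoTensor n M) (x : M) (α : Cotan n x) : Tan n x :=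
  (∑ i, A.form x α (EuclideanSpace.proj i : Model n →L[ℝ] ℝ) •
    (EuclideanSpace.single i (1 : ℝ) : Model n) : Model n)

/-- `♯α` is the vector that corresponds to `A(α, ·)` under `T_x M = (T*_x M)*`. -/
theorem ContraTwoTensor.apply_sharp (A : ContraTwoTensor n M) (x : M) (α β : Cotan n x) :
    β (A.sharp x α) = A.form x α β := by
  have key : ∀ γ : Model n →L[ℝ] ℝ,
      γ = ∑ i, γ (EuclideanSpace.single i (1 : ℝ)) •
        (EuclideanSpace.proj i : Model n →L[ℝ] ℝ) := by
    intro γ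
    refine ContinuousLinearMap.coe_injective
      ((EuclideanSpace.basisFun (Fin n) ℝ).toBasis.ext fun j => ?_)
    simp
  have h2 : A.form x α β = ∑ i, (β (EuclideanSpace.single i (1 : ℝ) : Model n)) *
      A.form x α (EuclideanSpace.proj i : Model n →L[ℝ] ℝ) := by
    conv_lhs => rw [show β = _ from key β]
    exact (map_sum (A.form x α) _ _).trans
      (Finset.sum_congr rfl fun i _ => by
        exact (map_smul (A.form x α) _ _))
  rw [h2]
  refine (map_sum β _ _).trans (Finset.sum_congr rfl fun i _ => ?_)
  exact (map_smul β _ _).trans (mul_comm _ _)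

/-- The vector field `A(df, ·)`. -/
def ContraTwoTensor.field (A : ContraTwoTensor n M) (f : M → ℝ) (x : M) : Tan n x :=
  A.sharp x (diff n f x)

/-- The function `A(df, dh)`. -/
def ContraTwoTensor.bracket (A : ContraTwoTensor n M) (f h : M → ℝ) (x : M) : ℝ :=
  A.form x (diff n f x) (diff n h x)

/-- The Lie derivative `ℒ_X ν` of a form of degree `n`, evaluated on the vector fields
`Y₁, …, Yₙ`:
`(ℒ_X ν)(Y₁, …, Yₙ) = X(ν(Y₁, …, Yₙ)) - ∑ᵢ ν(Y₁, …, [X, Yᵢ], …, Yₙ)`. -/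
def VolumeForm.lieDeriv (ν : VolumeForm n M) (X : ∀ x : M, Tan n x)
    (Y : Fin n → ∀ x : M, Tan n x) (x : M) : ℝ :=
  diff n (fun z => ν.form z (fun i => Y i z)) x (X x) -
    ∑ i, ν.form x (Function.update (fun j => Y j x) i
      (VectorField.mlieBracket 𝓘(ℝ, Model n) X (Y i) x))

variable [IsManifold 𝓘(ℝ, Model n) ∞ M]

/-- `(ℒ_X ν)_x = c • ν_x`, i.e. both sides agree on all vector fields that are smooth at `x`. -/
def VolumeForm.IsDivAt (ν : VolumeForm n M) (X : ∀ x : M, Tan n x) (x : M) (c : ℝ) : Prop :=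
  ∀ Y : Fin n → ∀ x : M, Tan n x,
    (∀ i, ContMDiffAt 𝓘(ℝ, Model n) 𝓘(ℝ, Model n).tangent ∞
      (fun z => (⟨z, Y i z⟩ : TangentBundle 𝓘(ℝ, Model n) M)) x) →
    ν.lieDeriv X Y x = c * ν.form x (fun i => Y i x)

open Classical in
/-- The divergence of a smooth vector field: the function `div_ν X` with
`ℒ_X ν = (div_ν X) ν`. -/
def VolumeForm.div (ν : VolumeForm n M) (X : ∀ x : M, Tan n x) (x : M) : ℝ :=
  if h : ∃ c, ν.IsDivAt X x c then h.choose else 0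

end Tensors

section Integration

variable {n : ℕ} {M : Type*} [TopologicalSpace M] [ChartedSpace (Model n) M]

/-- The measure `|ν(∂/∂x¹, …, ∂/∂xⁿ)| dx¹ ⋯ dxⁿ` on the domain of a chart `e`, as a measure on
`M`. -/
def VolumeForm.chartMeasure [MeasurableSpace M] (ν : VolumeForm n M)
    (e : OpenPartialHomeomorph M (Model n)) : Measure M :=
  (((volume : Measure (Model n)).restrict e.target).withDensity
    (fun y => ENNReal.ofReal |ν.form (e.symm y) (fun i => coordVec e i y)|)).map e.symm

variable [IsManifold 𝓘(ℝ, Model n) ∞ M] [T2Space M] [SigmaCompactSpace M]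

variable (n M) in
/-- A smooth partition of unity on `M`, indexed by the points of `M`, whose member with index `p`
is supported in the domain of the preferred chart at `p`. -/
def partition : SmoothPartitionOfUnity M 𝓘(ℝ, Model n) M Set.univ :=
  (SmoothPartitionOfUnity.exists_isSubordinate_chartAt_source 𝓘(ℝ, Model n) M).choose

/-- The measure of the volume form `ν`, so that `∫ f ∂(ν.measure) = ∫_M f ν` where `M` is oriented
by `ν`: the integral `∑ₚ ∫ ρₚ f ν` by means of charts and of a partition of unity `(ρₚ)`. -/
def VolumeForm.measure [MeasurableSpace M] (ν : VolumeForm n M) : Measure M :=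
  Measure.sum fun p : M => (ν.chartMeasure (chartAt (Model n) p)).withDensity
    (fun x => ENNReal.ofReal (partition n M p x))

end Integration

/-- The smooth functions with compact support, `C_c^∞(M)`. -/
def IsTest (n : ℕ) {M : Type*} [TopologicalSpace M] [ChartedSpace (Model n) M]
    (f : M → ℝ) : Prop :=
  ContMDiff 𝓘(ℝ, Model n) 𝓘(ℝ, ℝ) ∞ f ∧ HasCompactSupport f

/-- The data `(M, K, J, ν, E, S)` of a geometric GENERIC SDE. -/
structure System (n : ℕ) (M : Type*) [TopologicalSpace M] [ChartedSpace (Model n) M]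
    [IsManifold 𝓘(ℝ, Model n) ∞ M] where
  /-- the degenerate co-metric -/
  K : ContraTwoTensor n M
  K_symm : ∀ x α β, K.form x α β = K.form x β α
  K_nonneg : ∀ x α, 0 ≤ K.form x α α
  /-- the degenerate Poisson structure -/
  J : ContraTwoTensor n M
  J_alt : ∀ x α, J.form x α α = 0
  jacobi : ∀ f g h : M → ℝ, ContMDiff 𝓘(ℝ, Model n) 𝓘(ℝ, ℝ) ∞ f →
    ContMDiff 𝓘(ℝ, Model n) 𝓘(ℝ, ℝ) ∞ g → ContMDiff 𝓘(ℝ, Model n) 𝓘(ℝ, ℝ) ∞ h → ∀ x,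
    J.bracket f (J.bracket g h) x + J.bracket g (J.bracket h f) x +
      J.bracket h (J.bracket f g) x = 0
  /-- the volume form -/
  ν : VolumeForm n M
  /-- the energy -/
  E : M → ℝ
  E_smooth : ContMDiff 𝓘(ℝ, Model n) 𝓘(ℝ, ℝ) ∞ E
  /-- the entropy -/
  S : M → ℝ
  S_smooth : ContMDiff 𝓘(ℝ, Model n) 𝓘(ℝ, ℝ) ∞ S
  /-- non-interaction of `J` with `S` -/
  J_S : ∀ x α, J.form x (diff n S x) α = 0
  /-- non-interaction of `K` with `E` -/
  K_E : ∀ x α, K.form x (diff n E x) α = 0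
  /-- unimodularity of `ν` -/
  unimodular : ∀ h : M → ℝ, ContMDiff 𝓘(ℝ, Model n) 𝓘(ℝ, ℝ) ∞ h →
    ∀ x, ν.div (J.field h) x = 0

namespace System

variable {n : ℕ} {M : Type*} [TopologicalSpace M] [ChartedSpace (Model n) M]
  [IsManifold 𝓘(ℝ, Model n) ∞ M] (G : System n M)

/-- The sub-Laplacian `Δ_H f = div_ν(∇_H f)`, where `∇_H f = K(df, ·)`. -/
def subLaplacian (f : M → ℝ) (x : M) : ℝ := G.ν.div (G.K.field f) x

/-- The generator `L f = J(dE, df) + K(dS, df) + Δ_H f`. -/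
def L (f : M → ℝ) (x : M) : ℝ :=
  G.J.bracket G.E f x + G.K.bracket G.S f x + G.subLaplacian f x

/-- `L_a f = J(dE, df)`. -/
def La (f : M → ℝ) (x : M) : ℝ := G.J.bracket G.E f x

/-- `L_s f = Δ_{H,S} f = Δ_H f + K(dS, df)`. -/
def Ls (f : M → ℝ) (x : M) : ℝ := G.subLaplacian f x + G.K.bracket G.S f x

/-- The measure `e^S ν`. -/
def weightedMeasure [MeasurableSpace M] [T2Space M] [SigmaCompactSpace M] : Measure M :=
  G.ν.measure.withDensity (fun x => ENNReal.ofReal (Real.exp (G.S x)))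

end System

/-- `A` is the unbounded operator in `L²(M; μ)` with domain `C_c^∞(M)` that acts on it by
`f ↦ T f`: all `f` and `T f` are square integrable, and the graph of `A` consists of the pairs
of the classes of `f` and `T f`, for `f ∈ C_c^∞(M)`. -/
def IsOperatorOnTest (n : ℕ) {M : Type*} [TopologicalSpace M] [ChartedSpace (Model n) M]
    [MeasurableSpace M] (μ : Measure M) (T : (M → ℝ) → M → ℝ)
    (A : Lp ℝ 2 μ →ₗ.[ℝ] Lp ℝ 2 μ) : Prop :=
  (∀ f : M → ℝ, IsTest n f → MemLp f 2 μ ∧ MemLp (T f) 2 μ) ∧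
  ∀ u v : Lp ℝ 2 μ, (u, v) ∈ A.graph ↔ ∃ f : M → ℝ, IsTest n f ∧ u =ᵐ[μ] f ∧ v =ᵐ[μ] T f

end GGeneric

end

/-! Everything follows from one integration by parts. For a contravariant 2-tensor `A`, a smooth `f`
and a test function `g`, the divergence of the field `g • A(df, ·)` is `g div_ν(A(df, ·)) + A(df,
dg)`, called `divProduct`, and its `ν`-integral is zero (`integral_divProduct`).

With `A = K` and `g = e^S h` the integrand is `e^S (h L_s f + K(df, dh))`, because `K(df, d e^S) =
e^S K(df, dS)`. So `⟨L_s f, h⟩ = -∫ e^S K(df, dh) ν`, which is symmetric in `f` and `h`. With `A =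
J`, the function `E` in the role of `f`, and `g = e^S f h`, the divergence term vanishes by
unimodularity and the derivative of `e^S` vanishes because `J(dE, dS) = 0`. What remains is `e^S (f
L_a h + h L_a f)`, so `L_a` is antisymmetric. Together these give `⟨-L_a f + L_s f, h⟩ = ⟨f, L h⟩`
for all test functions `h`; since the domain of `L` is dense, this determines `L* f`.

The integration by parts is reduced by a partition of unity to `g` supported in one chart. Two facts
make the chart computation Euclidean. The divergence defined by the Lie derivative is `w⁻¹ ∑ ∂ᵢ(w
Vⁱ)`, where `w` is the density of `ν` (`div_eq`). The measure defined by the partition of unity is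
`|w| dy` in every chart (`measure_restrict_source`), which is the change of variables formula. The
integrand then becomes the divergence of a compactly supported smooth field on `ℝⁿ`.

For the operators to be well defined on `L²` classes, a class must contain at most one test
function. This holds because `e^S ν` charges every nonempty open set. -/

noncomputable section

open scoped Topology

namespace GGeneric

/-! ### Determinants and their derivatives on the model space -/

section ChartCalculus

variable {n : ℕ} {M : Type*} [TopologicalSpace M] [ChartedSpace (Model n) M]

/-- The derivative of a chart, as an endomorphism of the model space. -/
def chartDeriv (e : OpenPartialHomeomorph M (Model n)) (x : M) : Model n →L[ℝ] Model n :=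
  mfderiv 𝓘(ℝ, Model n) 𝓘(ℝ, Model n) e x

/-- The derivative of the inverse of a chart, as an endomorphism of the model space. -/
def chartSymmDeriv (e : OpenPartialHomeomorph M (Model n)) (y : Model n) :
    Model n →L[ℝ] Model n :=
  mfderiv 𝓘(ℝ, Model n) 𝓘(ℝ, Model n) e.symm y

/-- The representation of a vector field in a chart. -/
def chartRep (e : OpenPartialHomeomorph M (Model n)) (X : ∀ x : M, Tan n x) (y : Model n) :
    Model n :=
  chartDeriv e (e.symm y) (X (e.symm y))

/-- The density of a volume form in a chart. -/
def VolumeForm.density (ν : VolumeForm n M) (e : OpenPartialHomeomorph M (Model n))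
    (y : Model n) : ℝ :=
  ν.form (e.symm y) (fun i => coordVec e i y)

/-- A volume form at a point, as an alternating map on the model space. -/
def VolumeForm.modelForm (ν : VolumeForm n M) (x : M) : Model n [⋀^Fin n]→ₗ[ℝ] ℝ := ν.form x

variable (n) in
/-- The determinant on the model space. -/
def modelDet : Model n [⋀^Fin n]→ₗ[ℝ] ℝ := (EuclideanSpace.basisFun (Fin n) ℝ).toBasis.det

theorem modelDet_apply (v : Fin n → Model n) :
    modelDet n v = (Matrix.of fun i j => v j i).det := by
  rw [modelDet, Module.Basis.det_apply]
  congr 1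

theorem modelDet_single : modelDet n (fun i => EuclideanSpace.single i (1 : ℝ)) = 1 := by
  rw [modelDet_apply, ← Matrix.det_one (n := Fin n) (R := ℝ)]
  congr 1
  ext i j
  simp [Matrix.one_apply]

theorem modelDet_comp (A : Model n →L[ℝ] Model n) (v : Fin n → Model n) :
    modelDet n (fun i => A (v i)) = A.det * modelDet n v := by
  exact Module.Basis.det_comp _ (A : Model n →ₗ[ℝ] Model n) v

theorem alternating_eq (η : Model n [⋀^Fin n]→ₗ[ℝ] ℝ) (v : Fin n → Model n) :
    η v = η (fun i => EuclideanSpace.single i (1 : ℝ)) * modelDet n v := by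
  have h := AlternatingMap.eq_smul_basis_det (EuclideanSpace.basisFun (Fin n) ℝ).toBasis η
  have h2 := congrArg (fun f => f v) h
  have h3 : (⇑(EuclideanSpace.basisFun (Fin n) ℝ).toBasis : Fin n → Model n) =
      fun i => EuclideanSpace.single i (1 : ℝ) := by
    ext i; simp
  simpa [modelDet, h3] using h2

/-- By Cramer's rule the `i`-th summand is the `i`-th diagonal entry of `adj(V) B V`, where `V` has
columns `v` and `B` is the matrix of `A`. The trace is cyclic and `V adj(V) = det V`, so no
independence of the `v i` is needed. This is how the trace of `DX` enters the divergence. -/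
theorem sum_modelDet_update (A : Model n →L[ℝ] Model n) (v : Fin n → Model n) :
    ∑ i, modelDet n (Function.update v i (A (v i))) =
      (∑ i, A (EuclideanSpace.single i (1 : ℝ)) i) * modelDet n v := by
  set V : Matrix (Fin n) (Fin n) ℝ := Matrix.of fun i j => v j i with hV
  set B : Matrix (Fin n) (Fin n) ℝ :=
    Matrix.of fun i j => A (EuclideanSpace.single j (1 : ℝ)) i with hB
  have hA : ∀ (w : Model n) (k : Fin n), A w k = ∑ j, B k j * w j := by
    intro w k
    have hw : w = ∑ j, w j • (EuclideanSpace.single j (1 : ℝ) : Model n) := by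
      ext l
      simp [Pi.single_apply]
    conv_lhs => rw [hw]
    simp [hB, mul_comm]
  have h1 : ∀ i, modelDet n (Function.update v i (A (v i))) = (V.adjugate * (B * V)) i i := by
    intro i
    have : (V.adjugate * (B * V)) i i = (V.adjugate.mulVec fun k => A (v i) k) i := by
      simp only [Matrix.mul_apply, Matrix.mulVec, dotProduct, hA, hV, Matrix.of_apply]
    rw [this, ← Matrix.cramer_eq_adjugate_mulVec, Matrix.cramer_apply, modelDet_apply]
    congr 1
    ext k l
    by_cases h : l = i
    · subst h; simp
    · simp [h, hV]
  simp_rw [h1]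
  change Matrix.trace _ = _
  rw [← Matrix.mul_assoc, Matrix.trace_mul_comm, ← Matrix.mul_assoc, Matrix.mul_adjugate,
    modelDet_apply, ← hV]
  simp [Matrix.trace, hB, mul_comm, Finset.sum_mul]

/-- The determinant is a continuous multilinear map of its columns, so the chain rule differentiates
one column at a time. -/
theorem fderiv_modelDet (v : Fin n → Model n → Model n) (y : Model n)
    (hv : ∀ i, DifferentiableAt ℝ (v i) y) :
    DifferentiableAt ℝ (fun z => modelDet n (fun i => v i z)) y ∧ ∀ w,
    fderiv ℝ (fun z => modelDet n (fun i => v i z)) y w =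
      ∑ i, modelDet n (Function.update (fun j => v j y) i (fderiv ℝ (v i) y w)) := by
  let D : ContinuousMultilinearMap ℝ (fun _ : Fin n => Model n) ℝ :=
    ⟨(modelDet n).toMultilinearMap, by
      change Continuous fun v => modelDet n v
      simp_rw [modelDet_apply]
      exact Continuous.matrix_det (by fun_prop)⟩
  have h1 : HasFDerivAt (fun z => fun i => v i z)
      (ContinuousLinearMap.pi fun i => fderiv ℝ (v i) y) y :=
    hasFDerivAt_pi.2 fun i => (hv i).hasFDerivAt
  have h2 := (D.hasFDerivAt (fun i => v i y)).comp y h1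
  refine ⟨h2.differentiableAt, fun w => ?_⟩
  have h3 : fderiv ℝ (fun z => modelDet n (fun i => v i z)) y = _ := h2.fderiv
  rw [h3, ContinuousLinearMap.comp_apply, ContinuousMultilinearMap.linearDeriv_apply]
  rfl

end ChartCalculus

/-! ### Differentials, volume forms, vector fields and Lie brackets in a chart -/

section ChartCalculus

variable {n : ℕ} {M : Type*} [TopologicalSpace M] [ChartedSpace (Model n) M]
  [IsManifold 𝓘(ℝ, Model n) ∞ M]
  {e : OpenPartialHomeomorph M (Model n)} {y : Model n}

theorem chart_mdifferentiable (he : e ∈ atlas (Model n) M) :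
    e.MDifferentiable 𝓘(ℝ, Model n) 𝓘(ℝ, Model n) :=
  have : IsManifold 𝓘(ℝ, Model n) 1 M := IsManifold.of_le (n := ∞) (by simp)
  mdifferentiable_of_mem_atlas he

theorem chartDeriv_chartSymmDeriv (he : e ∈ atlas (Model n) M) (hy : y ∈ e.target)
    (w : Model n) : chartDeriv e (e.symm y) (chartSymmDeriv e y w) = w := by
  have h := (chart_mdifferentiable he).comp_symm_deriv hy
  exact congrArg (fun f => f w) h

/-- In finite dimension a one-sided inverse is two-sided. -/
theorem chartSymmDeriv_chartDeriv (he : e ∈ atlas (Model n) M) (hy : y ∈ e.target)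
    (v : Model n) : chartSymmDeriv e y (chartDeriv e (e.symm y) v) = v := by
  have h : (chartDeriv e (e.symm y) : Model n →ₗ[ℝ] Model n) ∘ₗ
      (chartSymmDeriv e y : Model n →ₗ[ℝ] Model n) = LinearMap.id :=
    LinearMap.ext fun w => chartDeriv_chartSymmDeriv he hy w
  have h2 := (LinearMap.comp_eq_id_comm ℝ (Model n)).1 h
  exact congrArg (fun f => f v) h2

theorem diff_eq_fderiv (he : e ∈ atlas (Model n) M) (hy : y ∈ e.target) {g : M → ℝ}
    (hg : DifferentiableAt ℝ (fun z => g (e.symm z)) y) (v : Model n) :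
    diff n g (e.symm y) v =
      fderiv ℝ (fun z => g (e.symm z)) y (chartDeriv e (e.symm y) v) := by
  have hx : e.symm y ∈ e.source := e.map_target hy
  have h1 : g =ᶠ[𝓝 (e.symm y)] (fun z => g (e.symm z)) ∘ e := by
    filter_upwards [e.open_source.mem_nhds hx] with z hz
    simp [e.left_inv hz]
  have h2 : MDifferentiableAt 𝓘(ℝ, Model n) 𝓘(ℝ, ℝ) (fun z => g (e.symm z)) (e (e.symm y)) := by
    rw [e.right_inv hy]; exact hg.mdifferentiableAt
  have h3 := mfderiv_comp (e.symm y) h2 ((chart_mdifferentiable he).mdifferentiableAt hx)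
  have h4 : diff n g (e.symm y) v =
      (mfderiv 𝓘(ℝ, Model n) 𝓘(ℝ, ℝ) g (e.symm y) : Model n →L[ℝ] ℝ) v := rfl
  rw [h4]
  have h5 : (mfderiv 𝓘(ℝ, Model n) 𝓘(ℝ, ℝ) g (e.symm y) : Model n →L[ℝ] ℝ) =
    (mfderiv 𝓘(ℝ, Model n) 𝓘(ℝ, ℝ) ((fun z => g (e.symm z)) ∘ e) (e.symm y) :
      Model n →L[ℝ] ℝ) := h1.mfderiv_eq
  have h6 : (mfderiv 𝓘(ℝ, Model n) 𝓘(ℝ, ℝ) (fun z => g (e.symm z)) (e (e.symm y)) :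
      Model n →L[ℝ] ℝ) = fderiv ℝ (fun z => g (e.symm z)) y := by
    rw [e.right_inv hy]; exact mfderiv_eq_fderiv
  rw [h5]
  refine (congrArg (fun f : Model n →L[ℝ] ℝ => f v) h3).trans ?_
  exact congrArg (fun f : Model n →L[ℝ] ℝ => f (chartDeriv e (e.symm y) v)) h6

/-- Pulled back by the inverse chart, `ν` becomes a top-degree form on `ℝⁿ`, hence a multiple of the
determinant; the factor is its value on the standard basis. -/
theorem VolumeForm.form_eq (ν : VolumeForm n M) (he : e ∈ atlas (Model n) M) {x : M}
    (hx : x ∈ e.source) (v : Fin n → Model n) :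
    ν.form x v = ν.density e (e x) * modelDet n (fun i => chartDeriv e x (v i)) := by
  obtain ⟨y, hy, rfl⟩ : ∃ y ∈ e.target, e.symm y = x := ⟨e x, e.map_source hx, e.left_inv hx⟩
  rw [e.right_inv hy]
  have h := alternating_eq ((ν.modelForm (e.symm y)).compLinearMap
    (chartSymmDeriv e y : Model n →ₗ[ℝ] Model n)) (fun i => chartDeriv e (e.symm y) (v i))
  simp only [AlternatingMap.compLinearMap_apply, ContinuousLinearMap.coe_coe,
    chartSymmDeriv_chartDeriv he hy] at h
  exact h

theorem VolumeForm.density_ne_zero (ν : VolumeForm n M) (he : e ∈ atlas (Model n) M)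
    (hy : y ∈ e.target) : ν.density e y ≠ 0 := by
  intro h
  refine ν.ne_zero (e.symm y) (AlternatingMap.ext fun v => ?_)
  have := ν.form_eq he (e.map_target hy) v
  rw [e.right_inv hy, h, zero_mul] at this
  exact this

omit [IsManifold 𝓘(ℝ, Model n) ∞ M] in
theorem VolumeForm.density_smooth (ν : VolumeForm n M) (he : e ∈ atlas (Model n) M) :
    ContDiffOn ℝ ∞ (ν.density e) e.target := ν.smooth e he

theorem chart_contMDiffAt (he : e ∈ atlas (Model n) M) {x : M} (hx : x ∈ e.source) :
    ContMDiffAt 𝓘(ℝ, Model n) 𝓘(ℝ, Model n) ∞ e x :=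
  (contMDiffOn_of_mem_maximalAtlas (IsManifold.subset_maximalAtlas he)).contMDiffAt
    (e.open_source.mem_nhds hx)

theorem chart_symm_contMDiffAt (he : e ∈ atlas (Model n) M) (hy : y ∈ e.target) :
    ContMDiffAt 𝓘(ℝ, Model n) 𝓘(ℝ, Model n) ∞ e.symm y :=
  (contMDiffOn_symm_of_mem_maximalAtlas (IsManifold.subset_maximalAtlas he)).contMDiffAt
    (e.open_target.mem_nhds hy)

theorem mfderiv_chart_isInvertible (he : e ∈ atlas (Model n) M) (hy : y ∈ e.target) :
    (mfderiv 𝓘(ℝ, Model n) 𝓘(ℝ, Model n) e (e.symm y)).IsInvertible := by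
  let E : Model n ≃L[ℝ] Model n := ContinuousLinearEquiv.equivOfInverse
    (chartDeriv e (e.symm y)) (chartSymmDeriv e y) (chartSymmDeriv_chartDeriv he hy)
    (chartDeriv_chartSymmDeriv he hy)
  exact ⟨E, rfl⟩

theorem mfderiv_chart_symm_isInvertible (he : e ∈ atlas (Model n) M) (hy : y ∈ e.target) :
    (mfderiv 𝓘(ℝ, Model n) 𝓘(ℝ, Model n) e.symm y).IsInvertible := by
  let E : Model n ≃L[ℝ] Model n := ContinuousLinearEquiv.equivOfInverse
    (chartSymmDeriv e y) (chartDeriv e (e.symm y)) (chartDeriv_chartSymmDeriv he hy)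
    (chartSymmDeriv_chartDeriv he hy)
  exact ⟨E, rfl⟩

theorem inverse_mfderiv_chart_symm (he : e ∈ atlas (Model n) M) (hy : y ∈ e.target)
    (v : Model n) :
    (mfderiv 𝓘(ℝ, Model n) 𝓘(ℝ, Model n) e.symm y).inverse v = chartDeriv e (e.symm y) v := by
  let E : Model n ≃L[ℝ] Model n := ContinuousLinearEquiv.equivOfInverse
    (chartSymmDeriv e y) (chartDeriv e (e.symm y)) (chartDeriv_chartSymmDeriv he hy)
    (chartSymmDeriv_chartDeriv he hy)
  exact congrArg (fun f : Model n →L[ℝ] Model n => f v) (ContinuousLinearMap.inverse_equiv E)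

theorem inverse_mfderiv_chart (he : e ∈ atlas (Model n) M) (hy : y ∈ e.target)
    (v : Model n) :
    (mfderiv 𝓘(ℝ, Model n) 𝓘(ℝ, Model n) e (e.symm y)).inverse v = chartSymmDeriv e y v := by
  let E : Model n ≃L[ℝ] Model n := ContinuousLinearEquiv.equivOfInverse
    (chartDeriv e (e.symm y)) (chartSymmDeriv e y) (chartSymmDeriv_chartDeriv he hy)
    (chartDeriv_chartSymmDeriv he hy)
  exact congrArg (fun f : Model n →L[ℝ] Model n => f v) (ContinuousLinearMap.inverse_equiv E)

theorem mpullback_chart_symm (he : e ∈ atlas (Model n) M) (hy : y ∈ e.target)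
    (X : ∀ x : M, Tan n x) :
    VectorField.mpullback 𝓘(ℝ, Model n) 𝓘(ℝ, Model n) e.symm X y = chartRep e X y :=
  inverse_mfderiv_chart_symm he hy _

theorem chartRep_contDiffAt (he : e ∈ atlas (Model n) M) (hy : y ∈ e.target)
    {X : ∀ x : M, Tan n x}
    (hX : ContMDiffAt 𝓘(ℝ, Model n) 𝓘(ℝ, Model n).tangent ∞
      (fun z => (⟨z, X z⟩ : TangentBundle 𝓘(ℝ, Model n) M)) (e.symm y)) :
    ContDiffAt ℝ ∞ (chartRep e X) y := by
  have : IsManifold 𝓘(ℝ, Model n) 1 M := IsManifold.of_le (n := ∞) (by simp)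
  have h := ContMDiffAt.mpullback_vectorField_preimage hX (chart_symm_contMDiffAt he hy)
    (mfderiv_chart_symm_isInvertible he hy) (by simp)
  have h2 := contMDiffAt_vectorSpace_iff_contDiffAt.1 h
  refine h2.congr_of_eventuallyEq ?_
  filter_upwards [e.open_target.mem_nhds hy] with z hz
  exact (mpullback_chart_symm he hz X).symm

/-- Near the point, `X` is the pullback by `e` of its own coordinate representation, and pullbacks
by local diffeomorphisms preserve smoothness. -/
theorem contMDiffAt_of_chartRep (he : e ∈ atlas (Model n) M) (hy : y ∈ e.target)
    {X : ∀ x : M, Tan n x} (hX : ContDiffAt ℝ ∞ (chartRep e X) y) :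
    ContMDiffAt 𝓘(ℝ, Model n) 𝓘(ℝ, Model n).tangent ∞
      (fun z => (⟨z, X z⟩ : TangentBundle 𝓘(ℝ, Model n) M)) (e.symm y) := by
  have : IsManifold 𝓘(ℝ, Model n) 1 M := IsManifold.of_le (n := ∞) (by simp)
  let V : ∀ z : Model n, TangentSpace 𝓘(ℝ, Model n) z := chartRep e X
  have hV : ContMDiffAt 𝓘(ℝ, Model n) 𝓘(ℝ, Model n).tangent ∞
      (fun z => (⟨z, V z⟩ : TangentBundle 𝓘(ℝ, Model n) (Model n))) (e (e.symm y)) := by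
    rw [e.right_inv hy]
    exact contMDiffAt_vectorSpace_iff_contDiffAt.2 hX
  have h := ContMDiffAt.mpullback_vectorField_preimage hV
    (chart_contMDiffAt he (e.map_target hy)) (mfderiv_chart_isInvertible he hy) (by simp)
  refine h.congr_of_eventuallyEq ?_
  filter_upwards [e.open_source.mem_nhds (e.map_target hy)] with x hx
  obtain ⟨z, hz, rfl⟩ : ∃ z ∈ e.target, e.symm z = x := ⟨e x, e.map_source hx, e.left_inv hx⟩
  congr 1
  have h1 := inverse_mfderiv_chart he hz (chartRep e X (e (e.symm z)))
  rw [e.right_inv hz] at h1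
  have h2 := chartSymmDeriv_chartDeriv he hz (X (e.symm z))
  have h3 : VectorField.mpullback 𝓘(ℝ, Model n) 𝓘(ℝ, Model n) e V (e.symm z) =
    (mfderiv 𝓘(ℝ, Model n) 𝓘(ℝ, Model n) e (e.symm z)).inverse (chartRep e X z) := by
    rw [VectorField.mpullback_apply]
    congr 1
    exact congrArg (chartRep e X) (e.right_inv hz)
  rw [h3]
  exact (h1.trans h2).symm

/-- The Lie bracket is natural under pullback by `e.symm`, and on the model space it has the usual
formula. -/
theorem chartDeriv_mlieBracket (he : e ∈ atlas (Model n) M) (hy : y ∈ e.target)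
    {X Y : ∀ x : M, Tan n x} (hX : ContDiffAt ℝ ∞ (chartRep e X) y)
    (hY : ContDiffAt ℝ ∞ (chartRep e Y) y) :
    chartDeriv e (e.symm y) (VectorField.mlieBracket 𝓘(ℝ, Model n) X Y (e.symm y)) =
      fderiv ℝ (chartRep e Y) y (chartRep e X y) - fderiv ℝ (chartRep e X) y (chartRep e Y y) := by
  have : IsManifold 𝓘(ℝ, Model n) (minSmoothness ℝ 2) M :=
    IsManifold.of_le (n := ∞) (by rw [minSmoothness_of_isRCLikeNormedField]; exact ENat.LEInfty.out)
  have h := VectorField.mpullback_mlieBracket (n := ∞)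
    ((contMDiffAt_of_chartRep he hy hX).mdifferentiableAt (by simp))
    ((contMDiffAt_of_chartRep he hy hY).mdifferentiableAt (by simp))
    (chart_symm_contMDiffAt he hy)
    (by rw [minSmoothness_of_isRCLikeNormedField]; exact ENat.LEInfty.out)
  have hE : ∀ V W : ∀ z : Model n, TangentSpace 𝓘(ℝ, Model n) z,
      VectorField.mlieBracket 𝓘(ℝ, Model n) V W y = VectorField.lieBracket ℝ V W y := by
    intro V W
    rw [← VectorField.mlieBracketWithin_univ, VectorField.mlieBracketWithin_eq_lieBracketWithin]
    exact congrFun (VectorField.lieBracketWithin_univ (𝕜 := ℝ) (V := V) (W := W)) y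
  rw [hE] at h
  have h1 := inverse_mfderiv_chart_symm he hy
    (VectorField.mlieBracket 𝓘(ℝ, Model n) X Y (e.symm y))
  refine h1.symm.trans (h.trans ?_)
  have hXe : VectorField.mpullback 𝓘(ℝ, Model n) 𝓘(ℝ, Model n) e.symm X =ᶠ[𝓝 y] chartRep e X := by
    filter_upwards [e.open_target.mem_nhds hy] with z hz using mpullback_chart_symm he hz X
  have hYe : VectorField.mpullback 𝓘(ℝ, Model n) 𝓘(ℝ, Model n) e.symm Y =ᶠ[𝓝 y] chartRep e Y := by
    filter_upwards [e.open_target.mem_nhds hy] with z hz using mpullback_chart_symm he hz Y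
  rw [hXe.lieBracket_vectorField_eq hYe]
  rfl

end ChartCalculus

/-! ### The divergence and the fields `A(df, ·)` in coordinates -/

section Divergence

variable {n : ℕ} {M : Type*} [TopologicalSpace M] [ChartedSpace (Model n) M]
  [IsManifold 𝓘(ℝ, Model n) ∞ M]
  {e : OpenPartialHomeomorph M (Model n)} {y : Model n}

/-- The divergence of a vector field of the model space with respect to a density. -/
def coordDiv (w : Model n → ℝ) (V : Model n → Model n) (y : Model n) : ℝ :=
  (fderiv ℝ w y (V y) + w y * ∑ i, fderiv ℝ V y (EuclideanSpace.single i (1 : ℝ)) i) / w y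

/-- In the chart `ν(Y₁, …, Yₙ) = w det(Y)`. Its derivative along `X` contains the terms with `DYᵢ X`
in column `i`. These cancel against the same terms of the brackets `[X, Yᵢ] = DYᵢ X - DX Yᵢ`. The
terms with `DX Yᵢ` are left, and they sum to `tr(DX) det(Y)`. -/
theorem VolumeForm.isDivAt_coordDiv (ν : VolumeForm n M) (he : e ∈ atlas (Model n) M)
    (hy : y ∈ e.target) {X : ∀ x : M, Tan n x} (hX : ContDiffAt ℝ ∞ (chartRep e X) y) :
    ν.IsDivAt X (e.symm y) (coordDiv (ν.density e) (chartRep e X) y) := by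
  intro Y hY
  have hx : e.symm y ∈ e.source := e.map_target hy
  have hYs : ∀ i, ContDiffAt ℝ ∞ (chartRep e (Y i)) y := fun i => chartRep_contDiffAt he hy (hY i)
  have hYd : ∀ i, DifferentiableAt ℝ (chartRep e (Y i)) y :=
    fun i => (hYs i).differentiableAt (by simp)
  have hwd : DifferentiableAt ℝ (ν.density e) y :=
    ((ν.density_smooth he).contDiffAt (e.open_target.mem_nhds hy)).differentiableAt (by simp)
  have hw := ν.density_ne_zero he hy
  obtain ⟨hDd, hD⟩ := fderiv_modelDet (fun i => chartRep e (Y i)) y hYd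
  have hloc : (fun z => ν.form (e.symm z) (fun i => Y i (e.symm z))) =ᶠ[𝓝 y]
      fun z => ν.density e z * modelDet n (fun i => chartRep e (Y i) z) := by
    filter_upwards [e.open_target.mem_nhds hy] with z hz
    refine (ν.form_eq he (e.map_target hz) _).trans ?_
    rw [e.right_inv hz]
    rfl
  have h1 : diff n (fun z => ν.form z (fun i => Y i z)) (e.symm y) (X (e.symm y)) =
      ν.density e y * (∑ i, modelDet n (Function.update (fun j => chartRep e (Y j) y) i
        (fderiv ℝ (chartRep e (Y i)) y (chartRep e X y)))) +
      modelDet n (fun i => chartRep e (Y i) y) * fderiv ℝ (ν.density e) y (chartRep e X y) := by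
    refine (diff_eq_fderiv (g := fun z => ν.form z (fun i => Y i z)) he hy
      ((hwd.mul hDd).congr_of_eventuallyEq hloc) _).trans ?_
    rw [hloc.fderiv_eq, fderiv_fun_mul hwd hDd]
    exact congrArg (fun t => ν.density e y * t + modelDet n (fun i => chartRep e (Y i) y) *
      fderiv ℝ (ν.density e) y (chartRep e X y)) (hD (chartRep e X y))
  have h2 : ∀ i, ν.form (e.symm y) (Function.update (fun j => Y j (e.symm y)) i
      (VectorField.mlieBracket 𝓘(ℝ, Model n) X (Y i) (e.symm y))) =
      ν.density e y * (modelDet n (Function.update (fun j => chartRep e (Y j) y) i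
        (fderiv ℝ (chartRep e (Y i)) y (chartRep e X y))) -
        modelDet n (Function.update (fun j => chartRep e (Y j) y) i
        (fderiv ℝ (chartRep e X) y (chartRep e (Y i) y)))) := by
    intro i
    refine (ν.form_eq he hx _).trans ?_
    rw [e.right_inv hy, ← AlternatingMap.map_update_sub, ← chartDeriv_mlieBracket he hy hX (hYs i)]
    congr 2
    funext j
    by_cases h : j = i
    · subst h
      rw [Function.update_self, Function.update_self]
    · rw [Function.update_of_ne h, Function.update_of_ne h]
      rfl
  have h3 : ν.form (e.symm y) (fun i => Y i (e.symm y)) =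
      ν.density e y * modelDet n (fun i => chartRep e (Y i) y) := hloc.self_of_nhds
  rw [VolumeForm.lieDeriv, h1, h3, Finset.sum_congr rfl fun i _ => h2 i, ← Finset.mul_sum,
    Finset.sum_sub_distrib, sum_modelDet_update, coordDiv]
  field_simp
  ring

/-- `div` is a chosen constant, so uniqueness is needed: on the coordinate frame `Y`, smooth near
the point, `ν(Y) = w ≠ 0`, which fixes the factor. -/
theorem VolumeForm.div_eq (ν : VolumeForm n M) (he : e ∈ atlas (Model n) M)
    (hy : y ∈ e.target) {X : ∀ x : M, Tan n x} (hX : ContDiffAt ℝ ∞ (chartRep e X) y) :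
    ν.div X (e.symm y) = coordDiv (ν.density e) (chartRep e X) y := by
  classical
  have hd := ν.isDivAt_coordDiv he hy hX
  have hex : ∃ c, ν.IsDivAt X (e.symm y) c := ⟨_, hd⟩
  rw [VolumeForm.div, dif_pos hex]
  let Y : Fin n → ∀ x : M, Tan n x := fun i x =>
    chartSymmDeriv e (e x) (EuclideanSpace.single i (1 : ℝ) : Model n)
  have hYrep : ∀ i, ∀ z ∈ e.target,
      chartRep e (Y i) z = (EuclideanSpace.single i (1 : ℝ) : Model n) := by
    intro i z hz
    simp only [chartRep, Y, e.right_inv hz]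
    exact chartDeriv_chartSymmDeriv he hz _
  have hY : ∀ i, ContMDiffAt 𝓘(ℝ, Model n) 𝓘(ℝ, Model n).tangent ∞
      (fun z => (⟨z, Y i z⟩ : TangentBundle 𝓘(ℝ, Model n) M)) (e.symm y) := by
    intro i
    refine contMDiffAt_of_chartRep he hy ((contDiffAt_const
      (c := (EuclideanSpace.single i (1 : ℝ) : Model n))).congr_of_eventuallyEq ?_)
    filter_upwards [e.open_target.mem_nhds hy] with z hz using hYrep i z hz
  have hne : ν.form (e.symm y) (fun i => Y i (e.symm y)) ≠ 0 := by
    have : ν.form (e.symm y) (fun i => Y i (e.symm y)) = ν.density e y := by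
      refine (ν.form_eq he (e.map_target hy) _).trans ?_
      have h : (fun i => chartDeriv e (e.symm y) (Y i (e.symm y))) =
          fun i => EuclideanSpace.single i (1 : ℝ) := funext fun i => hYrep i y hy
      rw [e.right_inv hy]
      refine (congrArg (fun v => ν.density e y * modelDet n v) h).trans ?_
      simp only [modelDet_single, mul_one]
    rw [this]
    exact ν.density_ne_zero he hy
  exact mul_right_cancel₀ hne ((hex.choose_spec Y hY).symm.trans (hd Y hY))

theorem contDiffOn_comp_chart_symm (he : e ∈ atlas (Model n) M) {f : M → ℝ}
    (hf : ContMDiff 𝓘(ℝ, Model n) 𝓘(ℝ, ℝ) ∞ f) :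
    ContDiffOn ℝ ∞ (fun z => f (e.symm z)) e.target :=
  contMDiffOn_iff_contDiffOn.1 (hf.comp_contMDiffOn
    (contMDiffOn_symm_of_mem_maximalAtlas (IsManifold.subset_maximalAtlas he)))

omit [IsManifold 𝓘(ℝ, Model n) ∞ M] in
theorem continuous_of_contDiffOn_charts {g : M → ℝ}
    (hg : ∀ e ∈ atlas (Model n) M, ContDiffOn ℝ ∞ (fun z => g (e.symm z)) e.target) :
    Continuous g := by
  rw [continuous_iff_continuousAt]
  intro x
  have hx := mem_chart_source (Model n) x
  have h1 := ((hg _ (chart_mem_atlas _ x)).continuousOn.continuousAt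
    ((chartAt (Model n) x).open_target.mem_nhds ((chartAt (Model n) x).map_source hx)))
  refine (h1.comp ((chartAt (Model n) x).continuousAt hx)).congr ?_
  filter_upwards [(chartAt (Model n) x).open_source.mem_nhds hx] with z hz
  simp [(chartAt (Model n) x).left_inv hz]

theorem coordDiff_apply (he : e ∈ atlas (Model n) M) (hy : y ∈ e.target) (i : Fin n)
    (v : Model n) : coordDiff e i (e.symm y) v = chartDeriv e (e.symm y) v i := by
  have h : (fun z => e (e.symm z) i) =ᶠ[𝓝 y] fun z => (EuclideanSpace.proj i : Model n →L[ℝ] ℝ) z := by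
    filter_upwards [e.open_target.mem_nhds hy] with z hz
    simp [e.right_inv hz]
  have hd : DifferentiableAt ℝ (fun z => e (e.symm z) i) y :=
    (EuclideanSpace.proj i : Model n →L[ℝ] ℝ).differentiableAt.congr_of_eventuallyEq h
  refine (diff_eq_fderiv (g := fun z => e z i) he hy hd v).trans ?_
  rw [h.fderiv_eq, ContinuousLinearMap.fderiv]
  rfl

theorem diff_eq_sum (he : e ∈ atlas (Model n) M) (hy : y ∈ e.target) {f : M → ℝ}
    (hf : DifferentiableAt ℝ (fun z => f (e.symm z)) y) :
    diff n f (e.symm y) = ∑ j, fderiv ℝ (fun z => f (e.symm z)) y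
      (EuclideanSpace.single j (1 : ℝ)) • coordDiff e j (e.symm y) := by
  refine ContinuousLinearMap.ext fun v => ?_
  refine (diff_eq_fderiv he hy hf v).trans ?_
  rw [sum_apply]
  set w : Model n := chartDeriv e (e.symm y) v with hw
  have hws : w = ∑ j, w j • (EuclideanSpace.single j (1 : ℝ) : Model n) := by
    ext l
    simp [Pi.single_apply]
  conv_lhs => rw [hws]
  rw [map_sum]
  refine Finset.sum_congr rfl fun j _ => ?_
  rw [map_smul, smul_eq_mul, mul_comm]
  exact congrArg _ (coordDiff_apply he hy j v).symm

/-- The coordinate expression of the vector field `A(df, ·)`. -/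
theorem ContraTwoTensor.chartRep_field (A : ContraTwoTensor n M) (he : e ∈ atlas (Model n) M)
    (hy : y ∈ e.target) {f : M → ℝ} (hf : DifferentiableAt ℝ (fun z => f (e.symm z)) y)
    (i : Fin n) :
    chartRep e (A.field f) y i = ∑ j, fderiv ℝ (fun z => f (e.symm z)) y
      (EuclideanSpace.single j (1 : ℝ)) *
        A.form (e.symm y) (coordDiff e j (e.symm y)) (coordDiff e i (e.symm y)) := by
  have h1 : chartRep e (A.field f) y i = coordDiff e i (e.symm y) (A.field f (e.symm y)) :=
    (coordDiff_apply he hy i _).symm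
  rw [h1, ContraTwoTensor.field, ContraTwoTensor.apply_sharp, diff_eq_sum he hy hf, map_sum,
    LinearMap.sum_apply]
  refine Finset.sum_congr rfl fun j _ => ?_
  rw [map_smul]
  rfl

theorem ContraTwoTensor.contDiffOn_chartRep_field (A : ContraTwoTensor n M)
    (he : e ∈ atlas (Model n) M) {f : M → ℝ} (hf : ContMDiff 𝓘(ℝ, Model n) 𝓘(ℝ, ℝ) ∞ f) :
    ContDiffOn ℝ ∞ (chartRep e (A.field f)) e.target := by
  have hfc := contDiffOn_comp_chart_symm he hf
  rw [contDiffOn_euclidean]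
  intro i
  have hfd : ∀ y ∈ e.target, DifferentiableAt ℝ (fun z => f (e.symm z)) y := fun y hy =>
    (hfc.contDiffAt (e.open_target.mem_nhds hy)).differentiableAt (by simp)
  refine ContDiffOn.congr ?_ fun y hy => A.chartRep_field he hy (hfd y hy) i
  refine ContDiffOn.sum fun j _ => ContDiffOn.mul ?_ (A.smooth e he j i)
  exact (hfc.fderiv_of_isOpen e.open_target (by simp)).clm_apply contDiffOn_const

theorem ContraTwoTensor.chartRep_field_contDiffAt (A : ContraTwoTensor n M)
    (he : e ∈ atlas (Model n) M) {f : M → ℝ} (hf : ContMDiff 𝓘(ℝ, Model n) 𝓘(ℝ, ℝ) ∞ f)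
    (hy : y ∈ e.target) : ContDiffAt ℝ ∞ (chartRep e (A.field f)) y :=
  (A.contDiffOn_chartRep_field he hf).contDiffAt (e.open_target.mem_nhds hy)

omit [IsManifold 𝓘(ℝ, Model n) ∞ M] in
theorem ContraTwoTensor.bracket_eq_diff (A : ContraTwoTensor n M) (f h : M → ℝ) (x : M) :
    A.bracket f h x = diff n h x (A.field f x) :=
  (A.apply_sharp x _ _).symm

theorem ContraTwoTensor.bracket_eq_fderiv (A : ContraTwoTensor n M) (he : e ∈ atlas (Model n) M)
    (hy : y ∈ e.target) (f : M → ℝ) {h : M → ℝ} (hh : ContMDiff 𝓘(ℝ, Model n) 𝓘(ℝ, ℝ) ∞ h) :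
    A.bracket f h (e.symm y) =
      fderiv ℝ (fun z => h (e.symm z)) y (chartRep e (A.field f) y) := by
  rw [A.bracket_eq_diff]
  exact diff_eq_fderiv he hy (((contDiffOn_comp_chart_symm he hh).contDiffAt
    (e.open_target.mem_nhds hy)).differentiableAt (by simp)) _

theorem ContraTwoTensor.continuous_bracket (A : ContraTwoTensor n M) {f h : M → ℝ}
    (hf : ContMDiff 𝓘(ℝ, Model n) 𝓘(ℝ, ℝ) ∞ f) (hh : ContMDiff 𝓘(ℝ, Model n) 𝓘(ℝ, ℝ) ∞ h) :
    Continuous (A.bracket f h) := by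
  refine continuous_of_contDiffOn_charts (n := n) fun e he => ?_
  refine ContDiffOn.congr ?_ fun y hy => A.bracket_eq_fderiv he hy f hh
  exact ((contDiffOn_comp_chart_symm he hh).fderiv_of_isOpen e.open_target (by simp)).clm_apply
    (A.contDiffOn_chartRep_field he hf)

theorem VolumeForm.continuous_div_field (ν : VolumeForm n M) (A : ContraTwoTensor n M) {f : M → ℝ}
    (hf : ContMDiff 𝓘(ℝ, Model n) 𝓘(ℝ, ℝ) ∞ f) : Continuous (ν.div (A.field f)) := by
  refine continuous_of_contDiffOn_charts (n := n) fun e he => ?_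
  refine ContDiffOn.congr ?_ fun y hy => ν.div_eq he hy (A.chartRep_field_contDiffAt he hf hy)
  have hw := ν.density_smooth he
  have hV := A.contDiffOn_chartRep_field he hf
  refine ContDiffOn.div ?_ hw fun y hy => ν.density_ne_zero he hy
  refine ((hw.fderiv_of_isOpen e.open_target (by simp)).clm_apply hV).add (hw.mul ?_)
  refine ContDiffOn.sum fun i _ => ?_
  have h := (hV.fderiv_of_isOpen e.open_target (m := ∞) (by simp)).clm_apply
    (contDiffOn_const (c := (EuclideanSpace.single i (1 : ℝ) : Model n)))
  exact contDiffOn_euclidean.1 h i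

end Divergence

/-! ### The measure of a volume form in charts -/

section ChartMeasure

variable {n : ℕ} {M : Type*} [TopologicalSpace M] [ChartedSpace (Model n) M]
  {e e' : OpenPartialHomeomorph M (Model n)}

omit [ChartedSpace (Model n) M] in
theorem measurableSet_symm_preimage_inter_target [MeasurableSpace M] [BorelSpace M]
    (e : OpenPartialHomeomorph M (Model n)) {A : Set M} (hA : MeasurableSet A) :
    MeasurableSet (e.symm ⁻¹' A ∩ e.target) := by
  have h1 : Measurable (e.target.domRestrict e.symm) :=
    (continuousOn_iff_continuous_domRestrict.1 e.continuousOn_symm).measurable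
  have h2 := e.open_target.measurableSet.subtype_image (h1 hA)
  convert h2 using 1
  ext z
  simp [and_comm, Set.domRestrict]

variable [IsManifold 𝓘(ℝ, Model n) ∞ M]

theorem hasFDerivAt_transition (he : e ∈ atlas (Model n) M) (he' : e' ∈ atlas (Model n) M)
    {y : Model n} (hy : y ∈ e.target) (hy' : e.symm y ∈ e'.source) :
    HasFDerivAt (fun z => e' (e.symm z))
      ((chartDeriv e' (e.symm y)).comp (chartSymmDeriv e y)) y := by
  have h1 := ((chart_mdifferentiable he).mdifferentiableAt_symm hy).hasMFDerivAt
  have h2 := ((chart_mdifferentiable he').mdifferentiableAt hy').hasMFDerivAt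
  exact (h2.comp y h1).hasFDerivAt

theorem VolumeForm.density_transition (ν : VolumeForm n M) (he' : e' ∈ atlas (Model n) M)
    {y : Model n} (hy' : e.symm y ∈ e'.source) :
    ν.density e y = ν.density e' (e' (e.symm y)) *
      ((chartDeriv e' (e.symm y)).comp (chartSymmDeriv e y)).det := by
  have h := modelDet_comp ((chartDeriv e' (e.symm y)).comp (chartSymmDeriv e y))
    (fun i => EuclideanSpace.single i (1 : ℝ))
  rw [modelDet_single, mul_one] at h
  rw [← h]
  exact ν.form_eq he' hy' _

variable [MeasurableSpace M] [BorelSpace M]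

omit [IsManifold 𝓘(ℝ, Model n) ∞ M] [MeasurableSpace M] [BorelSpace M] in
theorem VolumeForm.aemeasurable_density (ν : VolumeForm n M) (he : e ∈ atlas (Model n) M) :
    AEMeasurable (fun y => ENNReal.ofReal |ν.density e y|)
      ((volume : Measure (Model n)).restrict e.target) :=
  ((ν.density_smooth he).continuousOn.aemeasurable e.open_target.measurableSet).norm.ennreal_ofReal

omit [IsManifold 𝓘(ℝ, Model n) ∞ M] in
theorem VolumeForm.aemeasurable_chart_symm (ν : VolumeForm n M)
    (e : OpenPartialHomeomorph M (Model n)) :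
    AEMeasurable e.symm (((volume : Measure (Model n)).restrict e.target).withDensity
      (fun y => ENNReal.ofReal |ν.density e y|)) :=
  (e.continuousOn_symm.aemeasurable e.open_target.measurableSet).mono_ac
    (withDensity_absolutelyContinuous _ _)

omit [IsManifold 𝓘(ℝ, Model n) ∞ M] [BorelSpace M] in
theorem VolumeForm.chartMeasure_eq_map (ν : VolumeForm n M)
    (e : OpenPartialHomeomorph M (Model n)) :
    ν.chartMeasure e = (((volume : Measure (Model n)).restrict e.target).withDensity
      (fun y => ENNReal.ofReal |ν.density e y|)).map e.symm := rfl

omit [IsManifold 𝓘(ℝ, Model n) ∞ M] in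
theorem VolumeForm.chartMeasure_apply (ν : VolumeForm n M)
    (e : OpenPartialHomeomorph M (Model n)) {A : Set M} (hA : MeasurableSet A) :
    ν.chartMeasure e A =
      ∫⁻ y in e.symm ⁻¹' A ∩ e.target, ENNReal.ofReal |ν.density e y| := by
  rw [ν.chartMeasure_eq_map, Measure.map_apply_of_aemeasurable (ν.aemeasurable_chart_symm e) hA,
    withDensity_apply', Measure.restrict_restrict' e.open_target.measurableSet]

/-- This is the change of variables formula for the transition map: its Jacobian determinant is
exactly the factor between the two densities. Absolute values make the orientation of the charts
irrelevant. -/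
theorem VolumeForm.chartMeasure_eq (ν : VolumeForm n M) (he : e ∈ atlas (Model n) M)
    (he' : e' ∈ atlas (Model n) M) {A : Set M} (hA : MeasurableSet A) (h : A ⊆ e.source)
    (h' : A ⊆ e'.source) : ν.chartMeasure e A = ν.chartMeasure e' A := by
  rw [ν.chartMeasure_apply e hA, ν.chartMeasure_apply e' hA]
  have himage : (fun z => e' (e.symm z)) '' (e.symm ⁻¹' A ∩ e.target) =
      e'.symm ⁻¹' A ∩ e'.target := by
    ext z
    constructor
    · rintro ⟨y, ⟨hyA, hy⟩, rfl⟩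
      have hyA' : e.symm y ∈ A := hyA
      exact ⟨by simpa [e'.left_inv (h' hyA')] using hyA', e'.map_source (h' hyA')⟩
    · rintro ⟨hzA, hz⟩
      have hzA' : e'.symm z ∈ A := hzA
      refine ⟨e (e'.symm z), ⟨by simpa [e.left_inv (h hzA')] using hzA', e.map_source (h hzA')⟩, ?_⟩
      simp [e.left_inv (h hzA'), e'.right_inv hz]
  have hinj : Set.InjOn (fun z => e' (e.symm z)) (e.symm ⁻¹' A ∩ e.target) := by
    rintro y ⟨hyA, hy⟩ z ⟨hzA, hz⟩ hyz
    exact e.symm.injOn hy hz (e'.injOn (h' hyA) (h' hzA) hyz)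
  rw [← himage, lintegral_image_eq_lintegral_abs_det_fderiv_mul volume
    (measurableSet_symm_preimage_inter_target e hA)
    (fun y hy => (hasFDerivAt_transition he he' hy.2 (h' hy.1)).hasFDerivWithinAt) hinj]
  refine setLIntegral_congr_fun (measurableSet_symm_preimage_inter_target e hA) fun y hy => ?_
  simp only
  rw [ν.density_transition he' (h' hy.1), abs_mul, ENNReal.ofReal_mul (abs_nonneg _), mul_comm]

theorem VolumeForm.chartMeasure_restrict_eq (ν : VolumeForm n M) (he : e ∈ atlas (Model n) M)
    (he' : e' ∈ atlas (Model n) M) {A : Set M} (hA : MeasurableSet A) (h : A ⊆ e.source)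
    (h' : A ⊆ e'.source) : (ν.chartMeasure e).restrict A = (ν.chartMeasure e').restrict A := by
  ext B hB
  rw [Measure.restrict_apply hB, Measure.restrict_apply hB]
  exact ν.chartMeasure_eq he he' (hB.inter hA) (Set.inter_subset_right.trans h)
    (Set.inter_subset_right.trans h')

variable [T2Space M] [SigmaCompactSpace M]

omit [MeasurableSpace M] [BorelSpace M] in
theorem tsum_partition (x : M) : ∑' p, ENNReal.ofReal (partition n M p x) = 1 := by
  have hfin : (Function.support fun p => partition n M p x).Finite :=
    (partition n M).locallyFinite.point_finite x
  have h1 := (partition n M).sum_eq_one (Set.mem_univ x)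
  rw [finsum_eq_sum _ hfin] at h1
  rw [tsum_eq_sum (s := hfin.toFinset), ← ENNReal.ofReal_sum_of_nonneg, h1, ENNReal.ofReal_one]
  · exact fun p _ => (partition n M).nonneg p x
  · intro p hp
    have : partition n M p x = 0 := by simpa using hp
    simp [this]

-- A locally finite family of nonempty sets in a σ-compact space is countable. The partition is
-- indexed by all points of `M`, and the exchange of sum and integral requires a countable index
-- set.
variable (n M) in
omit [MeasurableSpace M] [BorelSpace M] in
theorem countable_partition :
    {p : M | (Function.support (partition n M p)).Nonempty}.Countable := by
  rw [← Set.countable_coe_iff, ← Set.countable_univ_iff]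
  exact ((partition n M).locallyFinite.comp_injective Subtype.val_injective).countable_univ
    fun p => p.2

omit [MeasurableSpace M] [BorelSpace M] in
theorem tsupport_partition_subset (p : M) :
    tsupport (partition n M p) ⊆ (chartAt (Model n) p).source :=
  (SmoothPartitionOfUnity.exists_isSubordinate_chartAt_source 𝓘(ℝ, Model n) M).choose_spec p

/-- The summand with index `p` only sees the part of `A` in the chart domain at `p`, where the
measures of that chart and of `e` agree. After replacing each chart measure by that of `e`, the
weights add up to 1. -/
theorem VolumeForm.measure_apply_of_subset_source (ν : VolumeForm n M)
    (he : e ∈ atlas (Model n) M) {A : Set M} (hA : MeasurableSet A) (h : A ⊆ e.source) :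
    ν.measure A = ν.chartMeasure e A := by
  have hmeas : ∀ p, Measurable fun x => ENNReal.ofReal (partition n M p x) := fun p =>
    ((partition n M p).contMDiff.continuous.measurable).ennreal_ofReal
  have hzero : ∀ p x, x ∉ (chartAt (Model n) p).source → ENNReal.ofReal (partition n M p x) = 0 := by
    intro p x hx
    rw [image_eq_zero_of_notMem_tsupport fun hx' => hx (tsupport_partition_subset p hx'),
      ENNReal.ofReal_zero]
  have hp : ∀ (μ : Measure M) p, ∫⁻ x in A, ENNReal.ofReal (partition n M p x) ∂μ =
      ∫⁻ x in A ∩ (chartAt (Model n) p).source, ENNReal.ofReal (partition n M p x) ∂μ := by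
    intro μ p
    rw [← lintegral_indicator hA,
      ← lintegral_indicator (hA.inter (chartAt (Model n) p).open_source.measurableSet)]
    congr 1
    ext x
    by_cases hx : x ∈ (chartAt (Model n) p).source
    · by_cases hxA : x ∈ A
      · rw [Set.indicator_of_mem hxA, Set.indicator_of_mem (Set.mem_inter hxA hx)]
      · rw [Set.indicator_of_notMem hxA, Set.indicator_of_notMem fun h => hxA h.1]
    · simp [Set.indicator, hzero p x hx]
  have hterm : ∀ p, ((ν.chartMeasure (chartAt (Model n) p)).withDensity
      (fun x => ENNReal.ofReal (partition n M p x))) A =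
      ∫⁻ x in A, ENNReal.ofReal (partition n M p x) ∂(ν.chartMeasure e) := by
    intro p
    rw [withDensity_apply _ hA, hp, hp, ν.chartMeasure_restrict_eq (chart_mem_atlas _ p) he
      (hA.inter (chartAt (Model n) p).open_source.measurableSet) Set.inter_subset_right
      (Set.inter_subset_left.trans h)]
  rw [VolumeForm.measure, Measure.sum_apply _ hA]
  simp_rw [hterm]
  have hsupp : ∀ g : M → ℝ≥0∞, (∀ p, ¬ (Function.support (partition n M p)).Nonempty → g p = 0) →
      ∑' p, g p = ∑' p : {p : M | (Function.support (partition n M p)).Nonempty}, g p := by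
    intro g hg
    refine (tsum_subtype_eq_of_support_subset fun p hp => ?_).symm
    by_contra hcon
    exact hp (hg p hcon)
  have hz : ∀ p, ¬ (Function.support (partition n M p)).Nonempty →
      ∀ x, ENNReal.ofReal (partition n M p x) = 0 := by
    intro p hp x
    have : partition n M p x = 0 := by
      by_contra hx
      exact hp ⟨x, hx⟩
    rw [this, ENNReal.ofReal_zero]
  have := (countable_partition n M).to_subtype
  rw [hsupp _ fun p hp => by simp [hz p hp], ← lintegral_tsum fun p => (hmeas _).aemeasurable]
  have hone : ∀ x, ∑' p : {p : M | (Function.support (partition n M p)).Nonempty},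
      ENNReal.ofReal (partition n M p x) = 1 := fun x => by
    rw [← hsupp (fun p => ENNReal.ofReal (partition n M p x)) fun p hp => hz p hp x,
      tsum_partition]
  simp_rw [hone]
  simp

theorem VolumeForm.measure_restrict_source (ν : VolumeForm n M) (he : e ∈ atlas (Model n) M) :
    ν.measure.restrict e.source = (ν.chartMeasure e).restrict e.source := by
  ext B hB
  rw [Measure.restrict_apply hB, Measure.restrict_apply hB]
  exact ν.measure_apply_of_subset_source he (hB.inter e.open_source.measurableSet)
    Set.inter_subset_right

/-- The density is continuous, hence bounded on a compact neighbourhood in the chart. Local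
finiteness makes continuous functions with compact support integrable. -/
instance VolumeForm.isLocallyFiniteMeasure (ν : VolumeForm n M) :
    IsLocallyFiniteMeasure ν.measure := by
  refine ⟨fun x => ?_⟩
  set e := chartAt (Model n) x
  have he : e ∈ atlas (Model n) M := chart_mem_atlas _ x
  have hx : x ∈ e.source := mem_chart_source _ x
  obtain ⟨K, hKn, hKt, hKc⟩ := local_compact_nhds (e.open_target.mem_nhds (e.map_source hx))
  have hcont : ContinuousOn (fun y => |ν.density e y|) K :=
    ((ν.density_smooth he).continuousOn.mono hKt).abs
  refine ⟨e.source ∩ e ⁻¹' (interior K), ?_, ?_⟩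
  · exact Filter.inter_mem (e.open_source.mem_nhds hx)
      (e.continuousAt hx (interior_mem_nhds.2 hKn))
  · have hopen : IsOpen (e.source ∩ e ⁻¹' (interior K)) :=
      e.isOpen_inter_preimage isOpen_interior
    rw [ν.measure_apply_of_subset_source he hopen.measurableSet Set.inter_subset_left,
      ν.chartMeasure_apply e hopen.measurableSet]
    refine lt_of_le_of_lt (lintegral_mono_set (t := K) ?_) ?_
    · rintro y ⟨⟨-, hy1⟩, hy2⟩
      have : e (e.symm y) ∈ interior K := hy1
      rw [e.right_inv hy2] at this
      exact interior_subset this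
    · exact (hcont.integrableOn_compact hKc).lintegral_lt_top

/-- The density vanishes nowhere, so a null open set would have a null open image in a chart.
Consequently continuous functions that agree almost everywhere are equal. -/
instance VolumeForm.isOpenPosMeasure (ν : VolumeForm n M) :
    ν.measure.IsOpenPosMeasure := by
  refine ⟨fun U hU ⟨x, hxU⟩ hU0 => ?_⟩
  set e := chartAt (Model n) x
  have he : e ∈ atlas (Model n) M := chart_mem_atlas _ x
  have hx : x ∈ e.source := mem_chart_source _ x
  have hopen : IsOpen (U ∩ e.source) := hU.inter e.open_source
  have h0 : ν.measure (U ∩ e.source) = 0 := measure_mono_null Set.inter_subset_left hU0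
  rw [ν.measure_apply_of_subset_source he hopen.measurableSet Set.inter_subset_right,
    ν.chartMeasure_apply e hopen.measurableSet] at h0
  have hV : IsOpen (e.symm ⁻¹' (U ∩ e.source) ∩ e.target) := by
    rw [Set.inter_comm]
    exact e.symm.isOpen_inter_preimage hopen
  have hne : (e.symm ⁻¹' (U ∩ e.source) ∩ e.target).Nonempty :=
    ⟨e x, by simp [e.left_inv hx, hx, hxU], e.map_source hx⟩
  have hpos := hV.measure_pos volume hne
  rw [lintegral_eq_zero_iff' ((ν.aemeasurable_density he).mono_measure
    (Measure.restrict_mono_set _ Set.inter_subset_right)),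
    Filter.EventuallyEq, ae_restrict_iff' hV.measurableSet] at h0
  refine hpos.ne' (measure_mono_null (fun y hy => ?_) h0)
  intro hcon
  have := hcon hy
  simp only [Pi.zero_apply, ENNReal.ofReal_eq_zero] at this
  exact ν.density_ne_zero he hy.2 (abs_nonpos_iff.1 this)

end ChartMeasure

/-! ### The divergence theorem on `ℝⁿ` -/

section Euclidean

variable {n : ℕ} {U K : Set (Model n)}

theorem contDiff_of_contDiffOn_of_eq_zero {F : Type*} [NormedAddCommGroup F] [NormedSpace ℝ F]
    {u : Model n → F} (hU : IsOpen U) (hK : IsCompact K)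
    (hKU : K ⊆ U) (hu : ContDiffOn ℝ ∞ u U) (h0 : ∀ y ∉ K, u y = 0) : ContDiff ℝ ∞ u := by
  rw [contDiff_iff_contDiffAt]
  intro y
  by_cases hy : y ∈ U
  · exact hu.contDiffAt (hU.mem_nhds hy)
  · refine (contDiffAt_const (c := (0 : F))).congr_of_eventuallyEq ?_
    filter_upwards [hK.isClosed.isOpen_compl.mem_nhds fun h => hy (hKU h)] with z hz using h0 z hz

theorem integral_fderiv_eq_zero {u : Model n → ℝ} (hu : ContDiff ℝ ∞ u)
    (hc : HasCompactSupport u) (v : Model n) :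
    Integrable (fun y => fderiv ℝ u y v) ∧ ∫ y, fderiv ℝ u y v = 0 := by
  have hi : Integrable (fun y => fderiv ℝ u y v) :=
    (hu.continuous_fderiv_apply (by simp)).comp (by fun_prop : Continuous fun y => (y, v))
      |>.integrable_of_hasCompactSupport (hc.fderiv_apply ℝ v)
  refine ⟨hi, ?_⟩
  -- Integration by parts against the constant 1, whose derivative vanishes.
  have h := integral_mul_fderiv_eq_neg_fderiv_mul_of_integrable (μ := volume)
    (f := fun _ : Model n => (1 : ℝ)) (g := u) (v := v) (by simp) (by simpa using hi)
    (by simpa using hu.continuous.integrable_of_hasCompactSupport hc) (fun _ _ => by fun_prop)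
    (fun y _ => hu.differentiable (by simp) y)
  simpa using h

/-- The divergence theorem for a vector field with compact support in an open set. -/
theorem setIntegral_sum_fderiv_eq_zero {V : Model n → Model n} (hU : IsOpen U) (hK : IsCompact K)
    (hKU : K ⊆ U) (hV : ContDiffOn ℝ ∞ V U) (h0 : ∀ y ∈ U, y ∉ K → V y = 0) :
    ∫ y in U, ∑ i, fderiv ℝ V y (EuclideanSpace.single i (1 : ℝ)) i = 0 := by
  classical
  -- The values of `V` outside `U` are arbitrary. The extension by zero is smooth on the whole space
  -- because `V` vanishes on `U` off the compact set `K`.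
  set W : Model n → Model n := U.indicator V with hW
  have hWU : ∀ y ∈ U, W =ᶠ[𝓝 y] V := fun y hy => by
    filter_upwards [hU.mem_nhds hy] with z hz using Set.indicator_of_mem hz V
  have hW0 : ∀ y ∉ K, W y = 0 := fun y hy => by
    by_cases hyU : y ∈ U
    · rw [(hWU y hyU).self_of_nhds, h0 y hyU hy]
    · exact Set.indicator_of_notMem hyU V
  have hWs : ContDiff ℝ ∞ W := contDiff_of_contDiffOn_of_eq_zero hU hK hKU
    (hV.congr fun y hy => (hWU y hy).self_of_nhds) hW0
  have hWi : ∀ i, ContDiff ℝ ∞ fun y => W y i := contDiff_euclidean.1 hWs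
  have hWc : ∀ i, HasCompactSupport fun y => W y i := fun i =>
    HasCompactSupport.intro hK fun y hy => by simp [hW0 y hy]
  have hcomp : ∀ y i, fderiv ℝ W y (EuclideanSpace.single i (1 : ℝ)) i =
      fderiv ℝ (fun z => W z i) y (EuclideanSpace.single i (1 : ℝ)) := by
    intro y i
    have h := ((EuclideanSpace.proj i : Model n →L[ℝ] ℝ).hasFDerivAt.comp y
      (hWs.differentiable (by simp) y).hasFDerivAt).fderiv
    exact (congrArg (fun f : Model n →L[ℝ] ℝ => f (EuclideanSpace.single i (1 : ℝ))) h).symm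
  have h1 : ∫ y in U, ∑ i, fderiv ℝ V y (EuclideanSpace.single i (1 : ℝ)) i =
      ∫ y in U, ∑ i, fderiv ℝ W y (EuclideanSpace.single i (1 : ℝ)) i :=
    setIntegral_congr_fun hU.measurableSet fun y hy => by
      simp only
      rw [(hWU y hy).fderiv_eq]
  rw [h1, setIntegral_eq_integral_of_forall_compl_eq_zero]
  · simp_rw [hcomp]
    rw [integral_finsetSum _ fun i _ => (integral_fderiv_eq_zero (hWi i) (hWc i) _).1]
    exact Finset.sum_eq_zero fun i _ => (integral_fderiv_eq_zero (hWi i) (hWc i) _).2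
  · intro y hy
    have : W =ᶠ[𝓝 y] fun _ => 0 := by
      filter_upwards [hK.isClosed.isOpen_compl.mem_nhds fun h => hy (hKU h)] with z hz
        using hW0 z hz
    rw [this.fderiv_eq]
    simp

/-- The sign of `w` is locally constant, and a constant factor cancels from the quotient. This
reconciles the signed density in the divergence with `|w|` in the measure. -/
theorem coordDiv_abs {w : Model n → ℝ} (V : Model n → Model n) {y : Model n}
    (hw : ContinuousAt w y) (h0 : w y ≠ 0) :
    coordDiv (fun z => |w z|) V y = coordDiv w V y := by
  rcases lt_or_gt_of_ne h0 with h | h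
  · have he : (fun z => |w z|) =ᶠ[𝓝 y] fun z => -w z := by
      filter_upwards [hw.eventually_lt continuousAt_const h] with z hz using abs_of_neg hz
    rw [coordDiv, coordDiv, he.fderiv_eq, fderiv_fun_neg, abs_of_neg h]
    simp only [neg_apply]
    field_simp
    ring
  · have he : (fun z => |w z|) =ᶠ[𝓝 y] w := by
      filter_upwards [continuousAt_const.eventually_lt hw h] with z hz using abs_of_pos hz
    rw [coordDiv, coordDiv, he.fderiv_eq, abs_of_pos h]

theorem sum_fderiv_smul {w g : Model n → ℝ} {V : Model n → Model n} {y : Model n}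
    (hw : DifferentiableAt ℝ w y) (hg : DifferentiableAt ℝ g y) (hV : DifferentiableAt ℝ V y)
    (h0 : w y ≠ 0) :
    ∑ i, fderiv ℝ (fun z => (g z * w z) • V z) y (EuclideanSpace.single i (1 : ℝ)) i =
      w y * (g y * coordDiv w V y + fderiv ℝ g y (V y)) := by
  have hsum : ∀ φ : Model n →L[ℝ] ℝ,
      ∑ i, φ (EuclideanSpace.single i (1 : ℝ)) * V y i = φ (V y) := by
    intro φ
    have hVs : V y = ∑ j, V y j • (EuclideanSpace.single j (1 : ℝ) : Model n) := by
      ext l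
      simp [Pi.single_apply]
    conv_rhs => rw [hVs]
    rw [map_sum]
    exact Finset.sum_congr rfl fun i _ => by rw [map_smul, smul_eq_mul, mul_comm]
  rw [fderiv_fun_smul (hg.fun_mul hw) hV, fderiv_fun_mul hg hw]
  simp only [add_apply, smul_apply,
    ContinuousLinearMap.smulRight_apply, PiLp.add_apply, PiLp.smul_apply, smul_eq_mul, add_mul,
    Finset.sum_add_distrib, mul_assoc, ← Finset.mul_sum]
  rw [hsum, hsum, coordDiv]
  field_simp
  ring

end Euclidean

/-! ### Integration by parts inside one chart -/

section IntegrationByParts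

variable {n : ℕ} {M : Type*} [TopologicalSpace M] [ChartedSpace (Model n) M]
  [IsManifold 𝓘(ℝ, Model n) ∞ M]
  {e : OpenPartialHomeomorph M (Model n)}

/-- The divergence of the vector field `g • A(df, ·)`, expanded by the product rule. -/
def VolumeForm.divProduct (ν : VolumeForm n M) (A : ContraTwoTensor n M) (f g : M → ℝ)
    (x : M) : ℝ :=
  g x * ν.div (A.field f) x + A.bracket f g x

omit [IsManifold 𝓘(ℝ, Model n) ∞ M] in
theorem diff_eq_zero_of_notMem_tsupport {g : M → ℝ} {x : M} (hx : x ∉ tsupport g) :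
    diff n g x = 0 := by
  have h : g =ᶠ[𝓝 x] fun _ => (0 : ℝ) := notMem_tsupport_iff_eventuallyEq.1 hx
  refine ContinuousLinearMap.ext fun v => ?_
  have h1 : (mfderiv 𝓘(ℝ, Model n) 𝓘(ℝ, ℝ) g x : Model n →L[ℝ] ℝ) =
      (mfderiv 𝓘(ℝ, Model n) 𝓘(ℝ, ℝ) (fun _ => (0 : ℝ)) x : Model n →L[ℝ] ℝ) := h.mfderiv_eq
  have h2 : (mfderiv 𝓘(ℝ, Model n) 𝓘(ℝ, ℝ) (fun _ : M => (0 : ℝ)) x : Model n →L[ℝ] ℝ) = 0 :=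
    mfderiv_const
  exact congrArg (fun φ : Model n →L[ℝ] ℝ => φ v) (h1.trans h2)

omit [IsManifold 𝓘(ℝ, Model n) ∞ M] in
theorem ContraTwoTensor.bracket_eq_zero_of_notMem_tsupport (A : ContraTwoTensor n M)
    (f : M → ℝ) {g : M → ℝ} {x : M} (hx : x ∉ tsupport g) : A.bracket f g x = 0 := by
  rw [ContraTwoTensor.bracket, diff_eq_zero_of_notMem_tsupport hx, map_zero]

theorem VolumeForm.divProduct_eq_zero_of_notMem_tsupport (ν : VolumeForm n M)
    (A : ContraTwoTensor n M) (f : M → ℝ) {g : M → ℝ} {x : M} (hx : x ∉ tsupport g) :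
    ν.divProduct A f g x = 0 := by
  rw [VolumeForm.divProduct, A.bracket_eq_zero_of_notMem_tsupport f hx,
    image_eq_zero_of_notMem_tsupport hx, zero_mul, zero_add]

variable [T2Space M] [SigmaCompactSpace M] [MeasurableSpace M] [BorelSpace M]

/-- In the chart the measure is `|w| dy`, and `|w|` times the integrand is the Euclidean divergence
of `g |w| V`, where `V` represents `A(df, ·)`. This field vanishes off the compact image of the
support of `g`. -/
theorem VolumeForm.integral_divProduct_of_tsupport_subset_source (ν : VolumeForm n M)
    (A : ContraTwoTensor n M) (he : e ∈ atlas (Model n) M) {f g : M → ℝ}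
    (hf : ContMDiff 𝓘(ℝ, Model n) 𝓘(ℝ, ℝ) ∞ f) (hg : IsTest n g) (hge : tsupport g ⊆ e.source) :
    ∫ x, ν.divProduct A f g x ∂ν.measure = 0 := by
  have hzero : ∀ x ∉ e.source, ν.divProduct A f g x = 0 := fun x hx =>
    ν.divProduct_eq_zero_of_notMem_tsupport A f fun h => hx (hge h)
  have hcont : Continuous (ν.divProduct A f g) :=
    (hg.1.continuous.mul (ν.continuous_div_field A hf)).add (A.continuous_bracket hf hg.1)
  rw [← setIntegral_eq_integral_of_forall_compl_eq_zero hzero, ν.measure_restrict_source he,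
    ν.chartMeasure_eq_map, Measure.restrict_map_of_aemeasurable (ν.aemeasurable_chart_symm e)
      e.open_source.measurableSet]
  -- The inverse chart maps the target into the source, so this restriction removes only a null set.
  have hres : (((volume : Measure (Model n)).restrict e.target).withDensity
      (fun y => ENNReal.ofReal |ν.density e y|)).restrict (e.symm ⁻¹' e.source) =
      ((volume : Measure (Model n)).restrict e.target).withDensity
      (fun y => ENNReal.ofReal |ν.density e y|) := by
    refine Measure.restrict_eq_self_of_ae_mem ?_
    refine (withDensity_absolutelyContinuous _ _).ae_le ?_
    filter_upwards [ae_restrict_mem e.open_target.measurableSet] with y hy using e.map_target hy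
  rw [hres, integral_map (ν.aemeasurable_chart_symm e) hcont.aestronglyMeasurable,
    integral_withDensity_eq_integral_toReal_smul₀ (ν.aemeasurable_density he)
      (by simp)]
  have hK : IsCompact (e '' tsupport g) := hg.2.isCompact.image_of_continuousOn
    (e.continuousOn.mono hge)
  have hKU : e '' tsupport g ⊆ e.target := by
    rintro _ ⟨x, hx, rfl⟩
    exact e.map_source (hge hx)
  have hws := ν.density_smooth he
  have hgs := contDiffOn_comp_chart_symm he hg.1
  have hVs := A.contDiffOn_chartRep_field he hf
  have habs : ContDiffOn ℝ ∞ (fun y => |ν.density e y|) e.target :=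
    hws.abs fun y hy => ν.density_ne_zero he hy
  rw [← setIntegral_sum_fderiv_eq_zero e.open_target hK hKU ((hgs.mul habs).smul hVs) ?_]
  · refine setIntegral_congr_fun e.open_target.measurableSet fun y hy => ?_
    have hn := e.open_target.mem_nhds hy
    have h := sum_fderiv_smul ((habs.contDiffAt hn).differentiableAt (by simp))
      ((hgs.contDiffAt hn).differentiableAt (by simp))
      ((hVs.contDiffAt hn).differentiableAt (by simp))
      (abs_ne_zero.2 (ν.density_ne_zero he hy))
    refine Eq.trans ?_ h.symm
    rw [coordDiv_abs _ (hws.contDiffAt hn).continuousAt (ν.density_ne_zero he hy),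
      ← ν.div_eq he hy (hVs.contDiffAt hn), ← A.bracket_eq_fderiv he hy f hg.1]
    simp [VolumeForm.divProduct]
  · intro y hy hyK
    have : g (e.symm y) = 0 := by
      by_contra hne
      exact hyK ⟨e.symm y, subset_tsupport _ hne, e.right_inv hy⟩
    simp [this]

end IntegrationByParts

/-! ### Product rules, linearity and global integration by parts -/

section TestFunctions

variable {n : ℕ} {M : Type*} [TopologicalSpace M] [ChartedSpace (Model n) M]

theorem IsTest.zero : IsTest n (0 : M → ℝ) := ⟨contMDiff_const, HasCompactSupport.zero⟩

theorem IsTest.add {f g : M → ℝ} (hf : IsTest n f) (hg : IsTest n g) : IsTest n (f + g) :=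
  ⟨hf.1.add hg.1, hf.2.add hg.2⟩

theorem IsTest.mul_left {f g : M → ℝ} (hf : ContMDiff 𝓘(ℝ, Model n) 𝓘(ℝ, ℝ) ∞ f)
    (hg : IsTest n g) : IsTest n (f * g) :=
  ⟨hf.mul hg.1, hg.2.mul_left⟩

theorem IsTest.smul (c : ℝ) {f : M → ℝ} (hf : IsTest n f) : IsTest n (c • f) :=
  IsTest.mul_left (f := fun _ => c) contMDiff_const hf

theorem diff_add {f g : M → ℝ} (hf : ContMDiff 𝓘(ℝ, Model n) 𝓘(ℝ, ℝ) ∞ f)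
    (hg : ContMDiff 𝓘(ℝ, Model n) 𝓘(ℝ, ℝ) ∞ g) (x : M) :
    diff n (f + g) x = diff n f x + diff n g x :=
  mvfderiv_add (hf.mdifferentiable (by simp) x) (hg.mdifferentiable (by simp) x)

theorem diff_mul {f g : M → ℝ} (hf : ContMDiff 𝓘(ℝ, Model n) 𝓘(ℝ, ℝ) ∞ f)
    (hg : ContMDiff 𝓘(ℝ, Model n) 𝓘(ℝ, ℝ) ∞ g) (x : M) :
    diff n (f * g) x = f x • diff n g x + g x • diff n f x :=
  mvfderiv_mul (hf.mdifferentiable (by simp) x) (hg.mdifferentiable (by simp) x)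

theorem diff_smul (c : ℝ) {f : M → ℝ} (hf : ContMDiff 𝓘(ℝ, Model n) 𝓘(ℝ, ℝ) ∞ f) (x : M) :
    diff n (c • f) x = c • diff n f x := by
  have h := diff_mul (f := fun _ => c) contMDiff_const hf x
  have h0 : diff n (fun _ : M => c) x = 0 := mvfderiv_const c
  rw [h0, smul_zero, add_zero] at h
  exact h

theorem contMDiff_exp {S : M → ℝ} (hS : ContMDiff 𝓘(ℝ, Model n) 𝓘(ℝ, ℝ) ∞ S) :
    ContMDiff 𝓘(ℝ, Model n) 𝓘(ℝ, ℝ) ∞ fun x => Real.exp (S x) :=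
  Real.contDiff_exp.contMDiff.comp hS

theorem ContraTwoTensor.bracket_add_right (A : ContraTwoTensor n M) (k : M → ℝ) {f g : M → ℝ}
    (hf : ContMDiff 𝓘(ℝ, Model n) 𝓘(ℝ, ℝ) ∞ f) (hg : ContMDiff 𝓘(ℝ, Model n) 𝓘(ℝ, ℝ) ∞ g)
    (x : M) : A.bracket k (f + g) x = A.bracket k f x + A.bracket k g x := by
  rw [ContraTwoTensor.bracket, diff_add hf hg, map_add]
  rfl

theorem ContraTwoTensor.bracket_smul_right (A : ContraTwoTensor n M) (k : M → ℝ) (c : ℝ)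
    {f : M → ℝ} (hf : ContMDiff 𝓘(ℝ, Model n) 𝓘(ℝ, ℝ) ∞ f) (x : M) :
    A.bracket k (c • f) x = c * A.bracket k f x := by
  rw [ContraTwoTensor.bracket, diff_smul c hf, map_smul]
  rfl

theorem ContraTwoTensor.bracket_mul_right (A : ContraTwoTensor n M) (k : M → ℝ) {f g : M → ℝ}
    (hf : ContMDiff 𝓘(ℝ, Model n) 𝓘(ℝ, ℝ) ∞ f) (hg : ContMDiff 𝓘(ℝ, Model n) 𝓘(ℝ, ℝ) ∞ g)
    (x : M) : A.bracket k (f * g) x = f x * A.bracket k g x + g x * A.bracket k f x := by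
  rw [ContraTwoTensor.bracket, diff_mul hf hg, map_add, map_smul, map_smul]
  rfl

/-- Coordinate projections are covectors. Linearity of `sharp` thus reduces, by `apply_sharp`, to
that of the bilinear form. -/
theorem tan_ext {x : M} {v w : Tan n x} (h : ∀ β : Cotan n x, β v = β w) : v = w :=
  PiLp.ext (x := (show Model n from v)) (y := (show Model n from w)) fun l =>
    h (EuclideanSpace.proj l : Model n →L[ℝ] ℝ)

theorem ContraTwoTensor.sharp_add (A : ContraTwoTensor n M) (x : M) (α β : Cotan n x) :
    A.sharp x (α + β) = A.sharp x α + A.sharp x β :=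
  tan_ext fun γ => by
    rw [map_add, A.apply_sharp, A.apply_sharp, A.apply_sharp, map_add, LinearMap.add_apply]

theorem ContraTwoTensor.sharp_smul (A : ContraTwoTensor n M) (x : M) (c : ℝ) (α : Cotan n x) :
    A.sharp x (c • α) = c • A.sharp x α :=
  tan_ext fun γ => by
    rw [map_smul, A.apply_sharp, A.apply_sharp, map_smul, LinearMap.smul_apply]

theorem ContraTwoTensor.field_add (A : ContraTwoTensor n M) {f g : M → ℝ}
    (hf : ContMDiff 𝓘(ℝ, Model n) 𝓘(ℝ, ℝ) ∞ f) (hg : ContMDiff 𝓘(ℝ, Model n) 𝓘(ℝ, ℝ) ∞ g) :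
    A.field (f + g) = A.field f + A.field g := by
  funext x
  rw [ContraTwoTensor.field, diff_add hf hg]
  exact A.sharp_add x _ _

theorem ContraTwoTensor.field_smul (A : ContraTwoTensor n M) (c : ℝ) {f : M → ℝ}
    (hf : ContMDiff 𝓘(ℝ, Model n) 𝓘(ℝ, ℝ) ∞ f) : A.field (c • f) = c • A.field f := by
  funext x
  rw [ContraTwoTensor.field, diff_smul c hf]
  exact A.sharp_smul x c _

variable [IsManifold 𝓘(ℝ, Model n) ∞ M]

theorem ContraTwoTensor.bracket_exp_right (A : ContraTwoTensor n M) (k : M → ℝ) {S : M → ℝ}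
    (hS : ContMDiff 𝓘(ℝ, Model n) 𝓘(ℝ, ℝ) ∞ S) (x : M) :
    A.bracket k (fun z => Real.exp (S z)) x = Real.exp (S x) * A.bracket k S x := by
  obtain ⟨e, he, y, hy, rfl⟩ : ∃ e ∈ atlas (Model n) M, ∃ y ∈ e.target, e.symm y = x :=
    ⟨_, chart_mem_atlas _ x, _, mem_chart_target (Model n) x,
      (chartAt (Model n) x).left_inv (mem_chart_source (Model n) x)⟩
  rw [A.bracket_eq_fderiv he hy k (contMDiff_exp hS), A.bracket_eq_fderiv he hy k hS,
    fderiv_exp (((contDiffOn_comp_chart_symm he hS).contDiffAt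
      (e.open_target.mem_nhds hy)).differentiableAt (by simp))]
  rfl

theorem VolumeForm.div_field_add (ν : VolumeForm n M) (A : ContraTwoTensor n M) {f g : M → ℝ}
    (hf : ContMDiff 𝓘(ℝ, Model n) 𝓘(ℝ, ℝ) ∞ f) (hg : ContMDiff 𝓘(ℝ, Model n) 𝓘(ℝ, ℝ) ∞ g)
    (x : M) : ν.div (A.field (f + g)) x = ν.div (A.field f) x + ν.div (A.field g) x := by
  obtain ⟨e, he, y, hy, rfl⟩ : ∃ e ∈ atlas (Model n) M, ∃ y ∈ e.target, e.symm y = x :=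
    ⟨_, chart_mem_atlas _ x, _, mem_chart_target (Model n) x,
      (chartAt (Model n) x).left_inv (mem_chart_source (Model n) x)⟩
  have h1 := A.chartRep_field_contDiffAt he hf hy
  have h2 := A.chartRep_field_contDiffAt he hg hy
  have h3 : chartRep e (A.field (f + g)) = chartRep e (A.field f) + chartRep e (A.field g) := by
    rw [A.field_add hf hg]
    exact funext fun z => map_add (chartDeriv e (e.symm z)) _ _
  rw [ν.div_eq he hy (A.chartRep_field_contDiffAt he (hf.add hg) hy), ν.div_eq he hy h1,
    ν.div_eq he hy h2, h3, coordDiv, coordDiv, coordDiv,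
    fderiv_add (h1.differentiableAt (by simp)) (h2.differentiableAt (by simp)), Pi.add_apply,
    map_add, ← add_div]
  congr 1
  simp only [add_apply, PiLp.add_apply, Finset.sum_add_distrib]
  ring

theorem VolumeForm.div_field_smul (ν : VolumeForm n M) (A : ContraTwoTensor n M) (c : ℝ)
    {f : M → ℝ} (hf : ContMDiff 𝓘(ℝ, Model n) 𝓘(ℝ, ℝ) ∞ f) (x : M) :
    ν.div (A.field (c • f)) x = c * ν.div (A.field f) x := by
  obtain ⟨e, he, y, hy, rfl⟩ : ∃ e ∈ atlas (Model n) M, ∃ y ∈ e.target, e.symm y = x :=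
    ⟨_, chart_mem_atlas _ x, _, mem_chart_target (Model n) x,
      (chartAt (Model n) x).left_inv (mem_chart_source (Model n) x)⟩
  have h1 := A.chartRep_field_contDiffAt he hf hy
  have h3 : chartRep e (A.field (c • f)) = c • chartRep e (A.field f) := by
    rw [A.field_smul c hf]
    exact funext fun z => map_smul (chartDeriv e (e.symm z)) c _
  have h2 : ContDiffAt ℝ ∞ (chartRep e (A.field (c • f))) y := by
    rw [h3]
    exact h1.const_smul c
  rw [ν.div_eq he hy h2, ν.div_eq he hy h1, h3, coordDiv, coordDiv,
    fderiv_const_smul (h1.differentiableAt (by simp)), Pi.smul_apply, map_smul, ← mul_div_assoc]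
  congr 1
  simp only [smul_apply, PiLp.smul_apply, smul_eq_mul, ← Finset.mul_sum]
  ring

theorem VolumeForm.div_field_eq_zero_of_notMem_tsupport (ν : VolumeForm n M)
    (A : ContraTwoTensor n M) {f : M → ℝ} (hf : ContMDiff 𝓘(ℝ, Model n) 𝓘(ℝ, ℝ) ∞ f) {x : M}
    (hx : x ∉ tsupport f) : ν.div (A.field f) x = 0 := by
  obtain ⟨e, he, y, hy, rfl⟩ : ∃ e ∈ atlas (Model n) M, ∃ y ∈ e.target, e.symm y = x :=
    ⟨_, chart_mem_atlas _ x, _, mem_chart_target (Model n) x,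
      (chartAt (Model n) x).left_inv (mem_chart_source (Model n) x)⟩
  -- The divergence differentiates the field, so vanishing on a neighbourhood is needed; the
  -- complement of the closed support provides it.
  have h0 : chartRep e (A.field f) =ᶠ[𝓝 y] fun _ => 0 := by
    have hc := e.continuousAt_symm hy
    filter_upwards [hc.preimage_mem_nhds ((isClosed_tsupport f).isOpen_compl.mem_nhds hx)] with z hz
    have h1 : A.field f (e.symm z) = 0 := by
      rw [ContraTwoTensor.field, diff_eq_zero_of_notMem_tsupport hz]
      have h2 := A.sharp_smul (e.symm z) 0 0
      rwa [zero_smul, zero_smul] at h2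
    rw [chartRep, h1]
    exact map_zero (chartDeriv e (e.symm z))
  rw [ν.div_eq he hy (A.chartRep_field_contDiffAt he hf hy), coordDiv, h0.fderiv_eq,
    h0.self_of_nhds]
  simp

theorem VolumeForm.divProduct_continuous (ν : VolumeForm n M) (A : ContraTwoTensor n M)
    {f g : M → ℝ} (hf : ContMDiff 𝓘(ℝ, Model n) 𝓘(ℝ, ℝ) ∞ f)
    (hg : ContMDiff 𝓘(ℝ, Model n) 𝓘(ℝ, ℝ) ∞ g) : Continuous (ν.divProduct A f g) :=
  (hg.continuous.mul (ν.continuous_div_field A hf)).add (A.continuous_bracket hf hg)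

variable [T2Space M]

theorem VolumeForm.divProduct_hasCompactSupport (ν : VolumeForm n M) (A : ContraTwoTensor n M)
    (f : M → ℝ) {g : M → ℝ} (hg : HasCompactSupport g) : HasCompactSupport (ν.divProduct A f g) :=
  HasCompactSupport.intro hg.isCompact fun _ hx => ν.divProduct_eq_zero_of_notMem_tsupport A f hx

variable [SigmaCompactSpace M] [MeasurableSpace M] [BorelSpace M]

theorem VolumeForm.integrable_divProduct (ν : VolumeForm n M) (A : ContraTwoTensor n M)
    {f g : M → ℝ} (hf : ContMDiff 𝓘(ℝ, Model n) 𝓘(ℝ, ℝ) ∞ f) (hg : IsTest n g) :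
    Integrable (ν.divProduct A f g) ν.measure :=
  (ν.divProduct_continuous A hf hg.1).integrable_of_hasCompactSupport
    (ν.divProduct_hasCompactSupport A f hg.2)

/-- Integration by parts on `M`. -/
theorem VolumeForm.integral_divProduct (ν : VolumeForm n M) (A : ContraTwoTensor n M)
    {f g : M → ℝ} (hf : ContMDiff 𝓘(ℝ, Model n) 𝓘(ℝ, ℝ) ∞ f) (hg : IsTest n g) :
    ∫ x, ν.divProduct A f g x ∂ν.measure = 0 := by
  classical
  -- Only finitely many members of the partition meet the compact support of `g`, so `g` is a finite
  -- sum of test functions each supported in a chart.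
  have hfin := (partition n M).locallyFinite.finite_nonempty_inter_compact hg.2.isCompact
  have htest : ∀ p, IsTest n (⇑(partition n M p) * g) := fun p =>
    IsTest.mul_left (partition n M p).contMDiff hg
  have hsum : g = ∑ p ∈ hfin.toFinset, ⇑(partition n M p) * g := by
    funext x
    rw [Finset.sum_apply]
    simp only [Pi.mul_apply, ← Finset.sum_mul]
    by_cases hx : x ∈ tsupport g
    · have h1 := (partition n M).sum_eq_one (Set.mem_univ x)
      rw [finsum_eq_sum_of_support_subset (s := hfin.toFinset)] at h1
      · rw [h1, one_mul]
      · intro p hp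
        simp only [Set.Finite.coe_toFinset, Set.mem_ofPred_eq]
        exact ⟨x, hp, hx⟩
    · rw [image_eq_zero_of_notMem_tsupport hx, mul_zero]
  -- The induction carries `IsTest` along, since additivity of `divProduct` in `g` and of the
  -- integral uses smoothness and integrability of the partial sums.
  have key : ∀ s : Finset M, IsTest n (∑ p ∈ s, ⇑(partition n M p) * g) ∧
      ∫ x, ν.divProduct A f (∑ p ∈ s, ⇑(partition n M p) * g) x ∂ν.measure = 0 := by
    intro s
    induction s using Finset.induction_on with
    | empty =>
      refine ⟨by simpa using IsTest.zero, ?_⟩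
      rw [Finset.sum_empty]
      refine integral_eq_zero_of_ae (Filter.Eventually.of_forall fun x => ?_)
      exact ν.divProduct_eq_zero_of_notMem_tsupport A f (by simp)
    | insert p s hp ih =>
      rw [Finset.sum_insert hp]
      refine ⟨(htest p).add ih.1, ?_⟩
      have hadd : ∀ x, ν.divProduct A f (⇑(partition n M p) * g +
          ∑ p ∈ s, ⇑(partition n M p) * g) x = ν.divProduct A f (⇑(partition n M p) * g) x +
          ν.divProduct A f (∑ p ∈ s, ⇑(partition n M p) * g) x := fun x => by
        simp only [VolumeForm.divProduct]
        rw [A.bracket_add_right f (htest p).1 ih.1.1, Pi.add_apply]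
        ring
      simp_rw [hadd]
      rw [integral_add (ν.integrable_divProduct A hf (htest p))
        (ν.integrable_divProduct A hf ih.1), ih.2, add_zero]
      exact ν.integral_divProduct_of_tsupport_subset_source A (chart_mem_atlas _ p) hf (htest p)
        ((tsupport_mul_subset_left).trans (tsupport_partition_subset p))
  rw [hsum]
  exact (key _).2

end TestFunctions

/-! ### Unbounded operators on `L²` with the test functions as domain -/

section Operators

variable {n : ℕ} {M : Type*} [TopologicalSpace M] [ChartedSpace (Model n) M]
  [MeasurableSpace M] [BorelSpace M] {μ : Measure M}

theorem IsTest.memLp [IsLocallyFiniteMeasure μ] {f : M → ℝ} (hf : IsTest n f) : MemLp f 2 μ :=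
  hf.1.continuous.memLp_of_hasCompactSupport hf.2

/-- A linear map from the test functions to the continuous functions with compact support is an
operator in `L²`. -/
theorem exists_isOperatorOnTest [IsLocallyFiniteMeasure μ] [μ.IsOpenPosMeasure]
    {T : (M → ℝ) → M → ℝ} (hT : ∀ f, IsTest n f → Continuous (T f) ∧ HasCompactSupport (T f))
    (hadd : ∀ f g, IsTest n f → IsTest n g → T (f + g) = T f + T g)
    (hsmul : ∀ (c : ℝ) f, IsTest n f → T (c • f) = c • T f) :
    ∃ A : Lp ℝ 2 μ →ₗ.[ℝ] Lp ℝ 2 μ, IsOperatorOnTest n μ T A := by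
  let G : Submodule ℝ (Lp ℝ 2 μ × Lp ℝ 2 μ) :=
    { carrier := {p | ∃ f : M → ℝ, IsTest n f ∧ p.1 =ᵐ[μ] f ∧ p.2 =ᵐ[μ] T f}
      add_mem' := by
        rintro p q ⟨f, hf, hf1, hf2⟩ ⟨g, hg, hg1, hg2⟩
        refine ⟨f + g, hf.add hg, (Lp.coeFn_add _ _).trans (hf1.add hg1), ?_⟩
        rw [hadd f g hf hg]
        exact (Lp.coeFn_add _ _).trans (hf2.add hg2)
      zero_mem' := by
        refine ⟨0, IsTest.zero, Lp.coeFn_zero _ _ _, ?_⟩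
        have h : T 0 = 0 := by
          have := hsmul 0 0 IsTest.zero
          simpa using this
        rw [h]
        exact Lp.coeFn_zero _ _ _
      smul_mem' := by
        rintro c p ⟨f, hf, hf1, hf2⟩
        refine ⟨c • f, hf.smul c, (Lp.coeFn_smul _ _).trans (hf1.const_smul c), ?_⟩
        rw [hsmul c f hf]
        exact (Lp.coeFn_smul _ _).trans (hf2.const_smul c) }
  -- The graph is single-valued: a test function that is zero almost everywhere is zero everywhere
  -- by continuity and full support of `μ`, and then `T f = T 0 = 0`.
  have hG : ∀ p ∈ G, p.1 = 0 → p.2 = 0 := by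
    rintro p ⟨f, hf, hf1, hf2⟩ hp
    have h0 : f =ᵐ[μ] 0 := by
      rw [hp] at hf1
      exact hf1.symm.trans (Lp.coeFn_zero _ _ _)
    have hf0 : f = 0 := (hf.1.continuous.ae_eq_iff_eq μ continuous_zero).1 h0
    have hT0 : T f = 0 := by
      have := hsmul 0 f hf
      rw [hf0] at this ⊢
      simpa using this
    rw [hT0] at hf2
    exact Lp.ext (hf2.trans (Lp.coeFn_zero _ _ _).symm)
  refine ⟨G.toLinearPMap, fun f hf => ⟨hf.memLp, ?_⟩, fun u v => ?_⟩
  · exact (hT f hf).1.memLp_of_hasCompactSupport (hT f hf).2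
  · rw [Submodule.toLinearPMap_graph_eq G hG]
    rfl

omit [BorelSpace M] in
theorem IsOperatorOnTest.exists_test {T : (M → ℝ) → M → ℝ} {A : Lp ℝ 2 μ →ₗ.[ℝ] Lp ℝ 2 μ}
    (hA : IsOperatorOnTest n μ T A) (u : A.domain) :
    ∃ f, IsTest n f ∧ (u : Lp ℝ 2 μ) =ᵐ[μ] f ∧ A u =ᵐ[μ] T f :=
  (hA.2 _ _).1 (A.mem_graph u)

omit [TopologicalSpace M] [ChartedSpace (Model n) M] [BorelSpace M] in
theorem inner_eq_integral {u v : Lp ℝ 2 μ} {f g : M → ℝ} (hu : u =ᵐ[μ] f) (hv : v =ᵐ[μ] g) :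
    inner ℝ u v = ∫ x, f x * g x ∂μ := by
  rw [L2.inner_def]
  refine integral_congr_ae ?_
  filter_upwards [hu, hv] with x hx1 hx2
  rw [hx1, hx2]
  simp [mul_comm]

/-- An `L²` function orthogonal to the domain is locally integrable and has zero integral against
every test function, so it vanishes by the fundamental lemma of the calculus of variations. -/
theorem IsOperatorOnTest.dense_domain [T2Space M] [SigmaCompactSpace M]
    [IsManifold 𝓘(ℝ, Model n) ∞ M] [IsLocallyFiniteMeasure μ] {T : (M → ℝ) → M → ℝ}
    {A : Lp ℝ 2 μ →ₗ.[ℝ] Lp ℝ 2 μ} (hA : IsOperatorOnTest n μ T A) :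
    Dense (A.domain : Set (Lp ℝ 2 μ)) := by
  rw [Submodule.dense_iff_topologicalClosure_eq_top, Submodule.topologicalClosure_eq_top_iff,
    Submodule.eq_bot_iff]
  intro u hu
  have hloc : LocallyIntegrable u μ := (Lp.memLp u).locallyIntegrable (by norm_num)
  have h0 := ae_eq_zero_of_integral_contMDiff_smul_eq_zero 𝓘(ℝ, Model n) hloc fun g hg hgc => by
    have hgt : IsTest n g := ⟨hg, hgc⟩
    have hmem : (hA.1 g hgt).1.toLp g ∈ A.domain := LinearPMap.mem_domain_of_mem_graph
      ((hA.2 _ ((hA.1 g hgt).2.toLp (T g))).2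
        ⟨g, hgt, MemLp.coeFn_toLp _, MemLp.coeFn_toLp _⟩)
    have h := (Submodule.mem_orthogonal _ _).1 hu _ hmem
    rwa [inner_eq_integral (MemLp.coeFn_toLp _) (Filter.EventuallyEq.refl _ _)] at h
  exact Lp.ext (Filter.EventuallyEq.trans h0 (Lp.coeFn_zero _ _ _).symm)

end Operators

/-! ### The operators `L_a` and `L_s` on test functions -/

section System

variable {n : ℕ} {M : Type*} [TopologicalSpace M] [ChartedSpace (Model n) M]
  [IsManifold 𝓘(ℝ, Model n) ∞ M] (G : System n M)

namespace System

theorem L_eq (f : M → ℝ) (x : M) : G.L f x = G.La f x + G.Ls f x := by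
  rw [L, La, Ls]
  ring

theorem J_antisymm (x : M) (α β : Cotan n x) : G.J.form x α β = -G.J.form x β α := by
  have h := G.J_alt x (α + β)
  simp only [map_add, LinearMap.add_apply, G.J_alt] at h
  linarith

theorem La_continuous {f : M → ℝ} (hf : IsTest n f) : Continuous (G.La f) :=
  G.J.continuous_bracket G.E_smooth hf.1

theorem Ls_continuous {f : M → ℝ} (hf : IsTest n f) : Continuous (G.Ls f) :=
  (G.ν.continuous_div_field G.K hf.1).add (G.K.continuous_bracket G.S_smooth hf.1)

theorem La_add {f g : M → ℝ} (hf : IsTest n f) (hg : IsTest n g) :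
    G.La (f + g) = G.La f + G.La g :=
  funext fun x => G.J.bracket_add_right G.E hf.1 hg.1 x

theorem La_smul (c : ℝ) {f : M → ℝ} (hf : IsTest n f) : G.La (c • f) = c • G.La f :=
  funext fun x => G.J.bracket_smul_right G.E c hf.1 x

theorem Ls_add {f g : M → ℝ} (hf : IsTest n f) (hg : IsTest n g) :
    G.Ls (f + g) = G.Ls f + G.Ls g := by
  funext x
  simp only [Ls, subLaplacian, Pi.add_apply]
  rw [G.ν.div_field_add G.K hf.1 hg.1, G.K.bracket_add_right G.S hf.1 hg.1]
  ring

theorem Ls_smul (c : ℝ) {f : M → ℝ} (hf : IsTest n f) : G.Ls (c • f) = c • G.Ls f := by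
  funext x
  simp only [Ls, subLaplacian, Pi.smul_apply, smul_eq_mul]
  rw [G.ν.div_field_smul G.K c hf.1, G.K.bracket_smul_right G.S c hf.1]
  ring

theorem L_eq_add (f : M → ℝ) : G.L f = G.La f + G.Ls f := funext (G.L_eq f)

variable [T2Space M]

omit [IsManifold 𝓘(ℝ, Model n) ∞ M] in
theorem _root_.GGeneric.ContraTwoTensor.bracket_hasCompactSupport (A : ContraTwoTensor n M)
    (k : M → ℝ) {f : M → ℝ} (hf : HasCompactSupport f) : HasCompactSupport (A.bracket k f) :=
  HasCompactSupport.intro hf.isCompact fun _ hx => A.bracket_eq_zero_of_notMem_tsupport k hx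

theorem La_hasCompactSupport {f : M → ℝ} (hf : IsTest n f) : HasCompactSupport (G.La f) :=
  G.J.bracket_hasCompactSupport G.E hf.2

theorem Ls_hasCompactSupport {f : M → ℝ} (hf : IsTest n f) : HasCompactSupport (G.Ls f) :=
  HasCompactSupport.intro hf.2.isCompact fun x hx => by
    rw [Ls, subLaplacian, G.ν.div_field_eq_zero_of_notMem_tsupport G.K hf.1 hx,
      G.K.bracket_eq_zero_of_notMem_tsupport G.S hx, add_zero]

variable [SigmaCompactSpace M] [MeasurableSpace M] [BorelSpace M]

instance : IsLocallyFiniteMeasure G.weightedMeasure :=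
  IsLocallyFiniteMeasure.withDensity_ofReal (Real.continuous_exp.comp G.S_smooth.continuous)

instance : G.weightedMeasure.IsOpenPosMeasure := by
  refine Measure.AbsolutelyContinuous.isOpenPosMeasure (μ := G.ν.measure) ?_
  exact withDensity_absolutelyContinuous' (f := fun x => ENNReal.ofReal (Real.exp (G.S x)))
    (Real.continuous_exp.comp G.S_smooth.continuous).measurable.ennreal_ofReal.aemeasurable
    (Filter.Eventually.of_forall fun x => by simp [Real.exp_pos])

theorem integral_weightedMeasure (φ : M → ℝ) :
    ∫ x, φ x ∂G.weightedMeasure = ∫ x, Real.exp (G.S x) * φ x ∂G.ν.measure := by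
  rw [weightedMeasure, integral_withDensity_eq_integral_toReal_smul
    (f := fun x => ENNReal.ofReal (Real.exp (G.S x)))
    (Real.continuous_exp.comp G.S_smooth.continuous).measurable.ennreal_ofReal (by simp)]
  simp [ENNReal.toReal_ofReal (Real.exp_nonneg _)]

omit [T2Space M] [SigmaCompactSpace M] [MeasurableSpace M] [BorelSpace M] in
theorem exp_mul_test {f : M → ℝ} (hf : IsTest n f) :
    IsTest n ((fun x => Real.exp (G.S x)) * f) :=
  IsTest.mul_left (contMDiff_exp G.S_smooth) hf

-- Differentiating the weight `e^S` produces the drift `K(dS, df)`, which completes `Δ_H f` to `L_s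
-- f`.
omit [T2Space M] [SigmaCompactSpace M] [MeasurableSpace M] [BorelSpace M] in
theorem divProduct_K (f : M → ℝ) {h : M → ℝ} (hh : IsTest n h) (x : M) :
    G.ν.divProduct G.K f ((fun x => Real.exp (G.S x)) * h) x =
      Real.exp (G.S x) * (G.Ls f x * h x + G.K.bracket f h x) := by
  have hsymm : G.K.bracket f G.S x = G.K.bracket G.S f x := G.K_symm _ _ _
  rw [VolumeForm.divProduct, G.K.bracket_mul_right f (contMDiff_exp G.S_smooth) hh.1,
    G.K.bracket_exp_right f G.S_smooth, hsymm, Ls, subLaplacian, Pi.mul_apply]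
  ring

/-- `L_s` is symmetric on test functions. -/
theorem integral_Ls_symm {f h : M → ℝ} (hf : IsTest n f) (hh : IsTest n h) :
    ∫ x, G.Ls f x * h x ∂G.weightedMeasure = ∫ x, f x * G.Ls h x ∂G.weightedMeasure := by
  have h1 := G.ν.integral_divProduct G.K hf.1 (G.exp_mul_test hh)
  have h2 := G.ν.integral_divProduct G.K hh.1 (G.exp_mul_test hf)
  -- The difference of the identities for `(f, h)` and `(h, f)`: the two terms `e^S K(df, dh)` and
  -- `e^S K(dh, df)` cancel.
  have h3 := integral_sub (G.ν.integrable_divProduct G.K hf.1 (G.exp_mul_test hh))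
    (G.ν.integrable_divProduct G.K hh.1 (G.exp_mul_test hf))
  rw [h1, h2, sub_zero] at h3
  have hi : ∀ {f h : M → ℝ}, IsTest n f → IsTest n h →
      Integrable (fun x => G.Ls f x * h x) G.weightedMeasure := fun hf hh =>
    ((G.Ls_continuous hf).mul hh.1.continuous).integrable_of_hasCompactSupport hh.2.mul_left
  rw [← sub_eq_zero]
  have h4 : ∫ x, f x * G.Ls h x ∂G.weightedMeasure = ∫ x, G.Ls h x * f x ∂G.weightedMeasure := by
    simp_rw [mul_comm]
  rw [h4, ← integral_sub (hi hf hh) (hi hh hf), integral_weightedMeasure, ← h3]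
  refine integral_congr_ae (Filter.Eventually.of_forall fun x => ?_)
  have hsymm : G.K.bracket f h x = G.K.bracket h f x := G.K_symm _ _ _
  simp only [G.divProduct_K f hh, G.divProduct_K h hf, hsymm]
  ring

/-- `L_a` is antisymmetric on test functions. -/
theorem integral_La_antisymm {f h : M → ℝ} (hf : IsTest n f) (hh : IsTest n h) :
    ∫ x, G.La f x * h x ∂G.weightedMeasure = -∫ x, f x * G.La h x ∂G.weightedMeasure := by
  have hfh : IsTest n (f * h) := IsTest.mul_left hf.1 hh
  have h1 := G.ν.integral_divProduct G.J G.E_smooth (G.exp_mul_test hfh)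
  have hi1 : Integrable (fun x => G.La f x * h x) G.weightedMeasure :=
    ((G.La_continuous hf).mul hh.1.continuous).integrable_of_hasCompactSupport hh.2.mul_left
  have hi2 : Integrable (fun x => f x * G.La h x) G.weightedMeasure :=
    (hf.1.continuous.mul (G.La_continuous hh)).integrable_of_hasCompactSupport hf.2.mul_right
  rw [eq_neg_iff_add_eq_zero, ← integral_add hi1 hi2, integral_weightedMeasure, ← h1]
  refine integral_congr_ae (Filter.Eventually.of_forall fun x => ?_)
  -- The weight `e^S` is constant along `J(dE, ·)`, so the Leibniz rule differentiates only `f` and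
  -- `h`.
  have hES : G.J.bracket G.E G.S x = 0 := by
    rw [ContraTwoTensor.bracket, G.J_antisymm, G.J_S, neg_zero]
  simp only [VolumeForm.divProduct]
  rw [G.unimodular G.E G.E_smooth, G.J.bracket_mul_right G.E (contMDiff_exp G.S_smooth) hfh.1,
    G.J.bracket_exp_right G.E G.S_smooth, hES, G.J.bracket_mul_right G.E hf.1 hh.1, La, La]
  ring

end System

end System

end GGeneric

end

/-! ### The operators in `L²(M; e^S ν)` and the adjoint of `L` -/

theorem mainTheorem4 {n : ℕ} {M : Type*} [TopologicalSpace M]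
    [ChartedSpace (GGeneric.Model n) M] [IsManifold 𝓘(ℝ, GGeneric.Model n) ∞ M]
    [T2Space M] [SigmaCompactSpace M] [MeasurableSpace M] [BorelSpace M]
    (G : GGeneric.System n M) :
    (∀ f : M → ℝ, GGeneric.IsTest n f → ∀ x, G.L f x = G.La f x + G.Ls f x) ∧
    ∃ opL opLa opLs : Lp ℝ 2 G.weightedMeasure →ₗ.[ℝ] Lp ℝ 2 G.weightedMeasure,
      GGeneric.IsOperatorOnTest n G.weightedMeasure G.L opL ∧
      GGeneric.IsOperatorOnTest n G.weightedMeasure G.La opLa ∧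
      GGeneric.IsOperatorOnTest n G.weightedMeasure G.Ls opLs ∧
      Dense (opL.domain : Set (Lp ℝ 2 G.weightedMeasure)) ∧
      -- `L_a` is antisymmetric and `L_s` is symmetric
      opLa.IsFormalAdjoint (-opLa) ∧
      opLs.IsFormalAdjoint opLs ∧
      -- the Hilbert space adjoint of `L` is defined on test functions and equals `-L_a + L_s` there
      ∀ f : M → ℝ, GGeneric.IsTest n f → ∀ u : Lp ℝ 2 G.weightedMeasure,
        u =ᵐ[G.weightedMeasure] f →
        ∃ hu : u ∈ opL.adjoint.domain,
          opL.adjoint ⟨u, hu⟩ =ᵐ[G.weightedMeasure]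
            fun x => -G.J.bracket G.E f x + (G.subLaplacian f x + G.K.bracket G.S f x) := by
  refine ⟨fun f _ => G.L_eq f, ?_⟩
  obtain ⟨opLa, hLa⟩ := GGeneric.exists_isOperatorOnTest (μ := G.weightedMeasure) (T := G.La)
    (fun f hf => ⟨G.La_continuous hf, G.La_hasCompactSupport hf⟩)
    (fun f g hf hg => G.La_add hf hg) (fun c f hf => G.La_smul c hf)
  obtain ⟨opLs, hLs⟩ := GGeneric.exists_isOperatorOnTest (μ := G.weightedMeasure) (T := G.Ls)
    (fun f hf => ⟨G.Ls_continuous hf, G.Ls_hasCompactSupport hf⟩)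
    (fun f g hf hg => G.Ls_add hf hg) (fun c f hf => G.Ls_smul c hf)
  obtain ⟨opL, hL⟩ := GGeneric.exists_isOperatorOnTest (μ := G.weightedMeasure) (T := G.L)
    (fun f hf => by
      rw [G.L_eq_add]
      exact ⟨(G.La_continuous hf).add (G.Ls_continuous hf),
        (G.La_hasCompactSupport hf).add (G.Ls_hasCompactSupport hf)⟩)
    (fun f g hf hg => by
      rw [G.L_eq_add, G.L_eq_add, G.L_eq_add, G.La_add hf hg, G.Ls_add hf hg]
      abel)
    (fun c f hf => by
      rw [G.L_eq_add, G.L_eq_add, G.La_smul c hf, G.Ls_smul c hf, smul_add])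
  refine ⟨opL, opLa, opLs, hL, hLa, hLs, hL.dense_domain, ?_, ?_, ?_⟩
  · intro u v
    obtain ⟨f, hf, huf, hAf⟩ := hLa.exists_test u
    -- The domain of `-opLa` is by definition that of `opLa`.
    obtain ⟨h, hh, hvh, hAh⟩ := hLa.exists_test (show opLa.domain from v)
    rw [LinearPMap.neg_apply, inner_neg_right]
    refine (GGeneric.inner_eq_integral hAf hvh).trans ((G.integral_La_antisymm hf hh).trans ?_)
    exact congrArg Neg.neg (GGeneric.inner_eq_integral huf hAh).symm
  · intro u v
    obtain ⟨f, hf, huf, hAf⟩ := hLs.exists_test u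
    obtain ⟨h, hh, hvh, hAh⟩ := hLs.exists_test v
    rw [GGeneric.inner_eq_integral hAf hvh, GGeneric.inner_eq_integral huf hAh]
    exact G.integral_Ls_symm hf hh
  · intro f hf u hu
    have hmem : MemLp (-G.La f + G.Ls f) 2 G.weightedMeasure :=
      (hLa.1 f hf).2.neg.add (hLs.1 f hf).2
    -- The class of `-L_a f + L_s f` represents the functional `v ↦ ⟨u, L v⟩`. This places `u` in
    -- the domain of the adjoint and, by density of the domain of `L`, identifies the value there.
    have key : ∀ v : opL.domain, inner ℝ (hmem.toLp _) (v : Lp ℝ 2 G.weightedMeasure) =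
        inner ℝ u (opL v) := by
      intro v
      obtain ⟨h, hh, hvh, hAh⟩ := hL.exists_test v
      rw [GGeneric.inner_eq_integral hmem.coeFn_toLp hvh, GGeneric.inner_eq_integral hu hAh]
      have hmul : ∀ {φ ψ : M → ℝ}, MemLp φ 2 G.weightedMeasure → MemLp ψ 2 G.weightedMeasure →
          Integrable (fun x => φ x * ψ x) G.weightedMeasure := fun h1 h2 => h1.integrable_mul h2
      have e1 : ∀ x, (-G.La f + G.Ls f) x * h x = G.Ls f x * h x - G.La f x * h x := fun x => by
        simp only [Pi.add_apply, Pi.neg_apply]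
        ring
      have e2 : ∀ x, f x * G.L h x = f x * G.Ls h x + f x * G.La h x := fun x => by
        rw [G.L_eq]
        ring
      simp_rw [e1, e2]
      rw [integral_sub (hmul (hLs.1 f hf).2 (hLs.1 h hh).1) (hmul (hLa.1 f hf).2 (hLa.1 h hh).1),
        integral_add (hmul (hLs.1 f hf).1 (hLs.1 h hh).2) (hmul (hLa.1 f hf).1 (hLa.1 h hh).2),
        G.integral_Ls_symm hf hh, G.integral_La_antisymm hf hh, sub_neg_eq_add]
    have hdom : u ∈ opL.adjoint.domain := LinearPMap.mem_adjoint_domain_of_exists u ⟨_, key⟩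
    refine ⟨hdom, ?_⟩
    rw [LinearPMap.adjoint_apply_eq hL.dense_domain ⟨u, hdom⟩ key]
    exact hmem.coeFn_toLp
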